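/- Let $d\ge 2$ and let $\rho_0=\frac1d\mathbb 1$ be the maximally mixed state on $\mathbb C^d$. Write $\|A\|_{Tr}=\frac12\operatorname{Tr}|A|$. A quantum measurement on $\mathbb C^d$ is a family $(M_y)_{y\in\mathcal Y}$ of $d\times d$ matrices with countable outcome set $\mathcal Y$ and $\sum_y M_y^*M_y=\mathbb 1$; on a state $\rho$ the outcome $y$ has probability $p_\rho(y)=\operatorname{Tr}[\rho M_y^*M_y]$ and leaves the state $\rho_{M\to y}=M_y\rho M_y^*/p_\rho(y)$. The measurement is $\alpha$-gentle if $\|\rho-\rho_{M\to y}\|_{Tr}\le\alpha$ for all states $\rho$ and all outcomes $y$ with $p_\rho(y)>0$. A measurement on $(\mathbb C^d)^{\otimes n}$ is locally-$\alpha$-gentle if its operators are $M^{(1)}_{y_1}\otimes\dots\otimes M^{(n)}_{y_n}$ for $\alpha$-gentle measurements $M^{(1)},\dots,M^{(n)}$ on $\mathbb C^d$. A randomized locally-$\alpha$-gentle test on $n$ copies first draws a random seed from an arbitrary probability space, then applies to $\rho^{\otimes n}$ a locally-$\alpha$-gentle measurement that may depend (measurably) on the seed, and finally decides between the hypotheses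 $$H_0:\ \rho=\rho_0\qquad\text{and}\qquad H_1:\ \|\rho-\rho_0\|_{Tr}>\epsilon$$ by a (measurable) function of the seed and of the $n$ outcomes. There is a universal constant $c>0$ such that for all $d\ge2$, $n\ge 0$, $0<\epsilon<\frac1{200}$ and $0<\alpha<\frac12$: if some randomized locally-$\alpha$-gentle test on $n$ copies decides correctly with probability at least $2/3$ under $\rho=\rho_0$, and with probability at least $2/3$ under every state $\rho$ with $\|\rho-\rho_0\|_{Tr}>\epsilon$, then $$n\ \ge\ c\,\frac{d^2}{\epsilon^2\alpha^2}.$$ -/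

import Mathlib

open MeasureTheory
open scoped ENNReal MatrixOrder ComplexOrder

/-- A (mixed) quantum state on the system with basis `ι`: a positive semidefinite matrix of
trace one. -/
def IsState {ι : Type*} [Fintype ι] (ρ : Matrix ι ι ℂ) : Prop :=
  ρ.PosSemidef ∧ ρ.trace = 1

/-- The trace norm in the normalisation `‖A‖ = (1/2) Tr |A|`, `|A| = √(A* A)`. -/
noncomputable def qTraceNorm {ι : Type*} [Fintype ι] [DecidableEq ι] (A : Matrix ι ι ℂ) : ℝ :=
  1 / 2 * (CFC.abs A).trace.re

/-- The family `M` of measurement operators with outcomes in `Y` resolves the identity: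
`∑ y, M_y* M_y = 1`. -/
def IsMeasurement {ι Y : Type*} [Fintype ι] [DecidableEq ι] (M : Y → Matrix ι ι ℂ) : Prop :=
  HasSum (fun y => (M y).conjTranspose * M y) 1

/-- The probability `Tr[ρ M_y* M_y]` of the outcome `y` when `ρ` is measured with `M`. -/
noncomputable def outcomeProb {ι Y : Type*} [Fintype ι] (M : Y → Matrix ι ι ℂ)
    (ρ : Matrix ι ι ℂ) (y : Y) : ℝ :=
  (ρ * ((M y).conjTranspose * M y)).trace.re

/-- The state `M_y ρ M_y* / Tr[ρ M_y* M_y]` after outcome `y` has been observed (used only when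
that outcome has positive probability). -/
noncomputable def postState {ι Y : Type*} [Fintype ι] (M : Y → Matrix ι ι ℂ)
    (ρ : Matrix ι ι ℂ) (y : Y) : Matrix ι ι ℂ :=
  (outcomeProb M ρ y)⁻¹ • (M y * ρ * (M y).conjTranspose)

/-- `α`-gentleness on the set of all states: no possible outcome moves a state by more than `α`
in trace norm. -/
def IsGentle {ι Y : Type*} [Fintype ι] [DecidableEq ι] (α : ℝ) (M : Y → Matrix ι ι ℂ) : Prop :=
  ∀ ρ : Matrix ι ι ℂ, IsState ρ → ∀ y : Y, 0 < outcomeProb M ρ y →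
    qTraceNorm (ρ - postState M ρ y) ≤ α

/-- The tensor (Kronecker) product `A₁ ⊗ ⋯ ⊗ Aₙ`, acting on `(ℂ^d)^{⊗ n}`, whose standard basis is
indexed by `Fin n → Fin d`. -/
def tensorMatrix {n d : ℕ} (A : Fin n → Matrix (Fin d) (Fin d) ℂ) :
    Matrix (Fin n → Fin d) (Fin n → Fin d) ℂ :=
  Matrix.of fun a b => ∏ i, A i (a i) (b i)

/-- A locally-`α`-gentle measurement on `(ℂ^d)^{⊗ n}`: a product measurement
`M_y = M¹_{y₁} ⊗ ⋯ ⊗ Mⁿ_{yₙ}` each of whose factors is an `α`-gentle measurement on `ℂ^d`. -/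
def IsLocallyGentle {n d : ℕ} {Y : Fin n → Type*} (α : ℝ)
    (M : (∀ i, Y i) → Matrix (Fin n → Fin d) (Fin n → Fin d) ℂ) : Prop :=
  ∃ L : ∀ i, Y i → Matrix (Fin d) (Fin d) ℂ,
    (∀ i, IsMeasurement (L i)) ∧ (∀ i, IsGentle α (L i)) ∧
    ∀ y, M y = tensorMatrix fun i => L i (y i)

/-- The maximally mixed state `(1/d) 𝟙`. -/
noncomputable def maxMixed (d : ℕ) : Matrix (Fin d) (Fin d) ℂ :=
  (d : ℂ)⁻¹ • (1 : Matrix (Fin d) (Fin d) ℂ)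

/-- A test on `n` copies based on a randomized locally-`α`-gentle measurement. A seed in `Ω` is
drawn first; it selects the locally-`α`-gentle measurement, and the decision (`true`: reject the
null hypothesis) may depend on the seed and on the outcomes of all the `n` measurements. -/
structure RandomizedGentleTest (n d : ℕ) (α : ℝ) (Ω : Type*) [MeasurableSpace Ω]
    (Y : Fin n → Type*) where
  /-- the measurement operators that are used for a given seed -/
  meas : Ω → (∀ i, Y i) → Matrix (Fin n → Fin d) (Fin n → Fin d) ℂ
  /-- the decision as a function of the seed and the outcomes -/
  decision : Ω → (∀ i, Y i) → Bool
  locallyGentle : ∀ ω, IsLocallyGentle α (meas ω)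
  measurable_meas : ∀ y a b, Measurable fun ω => meas ω y a b
  measurable_decision : ∀ y, Measurable fun ω => decision ω y

/-- The probability that the test takes the decision `b` on the input `ρ^{⊗ n}`, when the seed has
law `μ`. -/
noncomputable def RandomizedGentleTest.decisionProb {n d : ℕ} {α : ℝ} {Ω : Type*}
    [MeasurableSpace Ω] {Y : Fin n → Type*} (T : RandomizedGentleTest n d α Ω Y) (μ : Measure Ω)
    (ρ : Matrix (Fin d) (Fin d) ℂ) (b : Bool) : ℝ≥0∞ :=
  ∫⁻ ω, ∑' y, (if T.decision ω y = b then
    ENNReal.ofReal (outcomeProb (T.meas ω) (tensorMatrix fun _ => ρ) y) else 0) ∂μ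

/-- The test distinguishes `ρ = (1/d) 𝟙` from `‖ρ - (1/d) 𝟙‖ > ε` with success probability at
least `2/3`, whichever of the two holds. -/
def RandomizedGentleTest.Certifies {n d : ℕ} {α : ℝ} {Ω : Type*}
    [MeasurableSpace Ω] {Y : Fin n → Type*} (T : RandomizedGentleTest n d α Ω Y) (μ : Measure Ω)
    (ε : ℝ) : Prop :=
  2 / 3 ≤ T.decisionProb μ (maxMixed d) false ∧
    ∀ ρ : Matrix (Fin d) (Fin d) ℂ, IsState ρ → ε < qTraceNorm (ρ - maxMixed d) →
      2 / 3 ≤ T.decisionProb μ ρ true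

/-! The argument is a lower bound by a random mixture of alternatives. With `m = d / 2`, perturb the
maximally mixed state by `τ` times a Hermitian matrix whose off-diagonal blocks are `W` and its
transpose, `W` an `m × m` sign matrix. At least half of all `W` have operator norm at most `8 √m`
(`card_goodSigns`). For these the perturbation is a state, and Hölder's inequality puts it at trace
distance at least `τ m^(3/2) / 8` from the centre, so `τ` of order `ε / m^(3/2)` suffices.

Gentleness on pure states says that every vector is mapped almost parallel to itself. This makes the
off-diagonal block of each effect `M_y* M_y` small: its squared Hilbert–Schmidt norm is `O(α² m)`
times the square of the null probability of `y` (`IsGentle.sum_normSq_block_le`). The likelihood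
ratio of one outcome is therefore `1 + signForm a W` with `∑ a²` at most `v = O(τ² α² m) = O(ε² α² /
d²)`.

The second moment of the averaged likelihood ratio of `n` outcomes reduces, by convexity, to the
exponential moment of `n` times a product of two independent sign forms, which is at most `5 / 4`
when `n v ≤ 1 / 4` (`sum_sum_exp_signForm_le_of_symm`). Then the mean rejection probability over the
alternatives exceeds that under the null by at most `5 / 16 < 1 / 3` (`sum_tsum_prod_le`), for each
seed and hence on average, so no test succeeds (`not_certifies`). -/

/-- The linear form `∑ k, a k W k` evaluated at a vector `W` of signs. -/
noncomputable def signForm {κ : Type*} [Fintype κ] (a : κ → ℝ) (W : κ → ℤˣ) : ℝ :=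
  ∑ k, a k * ((W k : ℤ) : ℝ)

/-! ### Exponential moments of Rademacher sums. -/

section Signs

variable {κ : Type*} [Fintype κ]

lemma signForm_neg (a : κ → ℝ) (W : κ → ℤˣ) : signForm a (-W) = -signForm a W := by
  simp [signForm]

lemma mul_signForm (s : ℝ) (a : κ → ℝ) (W : κ → ℤˣ) :
    s * signForm a W = signForm (fun k => s * a k) W := by
  simp [signForm, Finset.mul_sum, mul_assoc]

lemma sum_exp_signForm [DecidableEq κ] (a : κ → ℝ) :
    ∑ W : κ → ℤˣ, Real.exp (signForm a W) = ∏ k, (2 * Real.cosh (a k)) := by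
  have h : ∀ k, 2 * Real.cosh (a k) =
      ∑ x ∈ (Finset.univ : Finset ℤˣ), Real.exp (a k * ((x : ℤ) : ℝ)) := by
    intro k
    rw [UnitsInt.univ, Finset.sum_pair (by decide), Real.cosh_eq]
    simp
    ring
  simp_rw [h]
  rw [Finset.prod_univ_sum, Fintype.piFinset_univ]
  refine Finset.sum_congr rfl fun W _ => ?_
  rw [signForm, Real.exp_sum]

lemma card_signs [DecidableEq κ] :
    (Fintype.card (κ → ℤˣ) : ℝ) = 2 ^ Fintype.card κ := by
  simp [Fintype.card_units_int]

/-- The sub-Gaussian bound: independence factors the sum into hyperbolic cosines, and `cosh x ≤ exp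
(x² / 2)`. -/
lemma sum_exp_signForm_le [DecidableEq κ] (a : κ → ℝ) (s : ℝ) {v : ℝ} (hv : ∑ k, a k ^ 2 ≤ v) :
    ∑ W : κ → ℤˣ, Real.exp (s * signForm a W) ≤
      Fintype.card (κ → ℤˣ) * Real.exp (s ^ 2 * v / 2) := by
  simp_rw [mul_signForm]
  rw [sum_exp_signForm, Finset.prod_mul_distrib, card_signs]
  simp only [Finset.prod_const, Finset.card_univ]
  gcongr
  calc ∏ k, Real.cosh (s * a k) ≤ ∏ k, Real.exp ((s * a k) ^ 2 / 2) :=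
        Finset.prod_le_prod (fun k _ => (Real.cosh_pos _).le)
          fun k _ => Real.cosh_le_exp_half_sq _
    _ = Real.exp (s ^ 2 * (∑ k, a k ^ 2) / 2) := by
        rw [← Real.exp_sum, Finset.mul_sum, Finset.sum_div]
        simp_rw [mul_pow]
    _ ≤ _ := by gcongr

lemma integrable_exp_mul_sq_gaussian {b : ℝ} (hb : b < 1) :
    Integrable (fun z => Real.exp (b / 2 * z ^ 2)) (ProbabilityTheory.gaussianReal 0 1) := by
  rw [ProbabilityTheory.gaussianReal_of_var_ne_zero _ one_ne_zero,
    integrable_withDensity_iff (ProbabilityTheory.measurable_gaussianPDF _ _)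
      (Filter.Eventually.of_forall fun _ => by simp [ProbabilityTheory.gaussianPDF])]
  have h : Integrable fun z : ℝ => (√(2 * Real.pi))⁻¹ * Real.exp (-((1 - b) / 2) * z ^ 2) :=
    (integrable_exp_neg_mul_sq (by linarith)).const_mul _
  refine h.congr (Filter.Eventually.of_forall fun z => ?_)
  simp only [ProbabilityTheory.toReal_gaussianPDF, ProbabilityTheory.gaussianPDFReal]
  rw [mul_comm (Real.exp _), mul_assoc, ← Real.exp_add]
  simp only [NNReal.coe_one, mul_one, sub_zero]
  ring_nf

lemma integral_exp_mul_sq_gaussian {b : ℝ} (hb : b < 1) :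
    ∫ z, Real.exp (b / 2 * z ^ 2) ∂(ProbabilityTheory.gaussianReal 0 1) = (√(1 - b))⁻¹ := by
  rw [ProbabilityTheory.integral_gaussianReal_eq_integral_smul one_ne_zero]
  have h : ∀ z : ℝ, ProbabilityTheory.gaussianPDFReal 0 1 z • Real.exp (b / 2 * z ^ 2) =
      (√(2 * Real.pi))⁻¹ * Real.exp (-((1 - b) / 2) * z ^ 2) := by
    intro z
    simp only [ProbabilityTheory.gaussianPDFReal, smul_eq_mul]
    rw [mul_assoc, ← Real.exp_add]
    simp only [NNReal.coe_one, mul_one, sub_zero]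
    ring_nf
  simp_rw [h]
  rw [integral_const_mul, integral_gaussian, ← Real.sqrt_inv, ← Real.sqrt_inv,
    ← Real.sqrt_mul (by positivity)]
  congr 1
  have : (1 - b) ≠ 0 := by linarith
  field_simp

/-- Writing the exponential of a square as a Gaussian average of exponentials of linear forms lets
the sub-Gaussian bound apply to squares. -/
lemma exp_half_sq_eq_integral (x : ℝ) :
    Real.exp (x ^ 2 / 2) = ∫ z, Real.exp (x * z) ∂(ProbabilityTheory.gaussianReal 0 1) := by
  have h := congrFun (ProbabilityTheory.mgf_id_gaussianReal (μ := 0) (v := 1)) x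
  simp only [ProbabilityTheory.mgf, id] at h
  rw [h]
  simp

lemma sum_exp_sq_signForm_le [DecidableEq κ] (a : κ → ℝ) {s v : ℝ} (hv : ∑ k, a k ^ 2 ≤ v)
    (hs : s ^ 2 * v < 1) :
    ∑ W : κ → ℤˣ, Real.exp ((s * signForm a W) ^ 2 / 2) ≤
      Fintype.card (κ → ℤˣ) * (√(1 - s ^ 2 * v))⁻¹ := by
  simp_rw [exp_half_sq_eq_integral]
  have hint : ∀ x : ℝ, Integrable (fun z => Real.exp (x * z))
      (ProbabilityTheory.gaussianReal 0 1) := fun x =>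
    ProbabilityTheory.integrable_exp_mul_gaussianReal x
  rw [← integral_finsetSum _ fun W _ => hint _, ← integral_exp_mul_sq_gaussian hs,
    ← integral_const_mul]
  refine integral_mono (integrable_finsetSum _ fun W _ => hint _)
    ((integrable_exp_mul_sq_gaussian hs).const_mul _) fun z => ?_
  have := sum_exp_signForm_le a (s * z) hv
  calc _ = ∑ W : κ → ℤˣ, Real.exp (s * z * signForm a W) := by
        refine Finset.sum_congr rfl fun W _ => ?_
        ring_nf
    _ ≤ _ := this
    _ = _ := by ring_nf

/-- For fixed `W` the sum over `W'` is sub-Gaussian, which leaves the exponential of a square in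
`W`; the Gaussian linearisation handles it. -/
lemma sum_sum_exp_signForm_le [DecidableEq κ] (a : κ → ℝ) {x v : ℝ} (hv : ∑ k, a k ^ 2 ≤ v)
    (hx : (x * v) ^ 2 < 1) :
    ∑ W : κ → ℤˣ, ∑ W' : κ → ℤˣ, Real.exp (x * (signForm a W * signForm a W')) ≤
      Fintype.card (κ → ℤˣ) ^ 2 * (√(1 - (x * v) ^ 2))⁻¹ := by
  have hv0 : 0 ≤ v := le_trans (Finset.sum_nonneg fun _ _ => sq_nonneg _) hv
  have hs : (x * √v) ^ 2 * v = (x * v) ^ 2 := by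
    rw [mul_pow, Real.sq_sqrt hv0]; ring
  have h2 := sum_exp_sq_signForm_le a hv (s := x * √v) (by rwa [hs])
  rw [hs] at h2
  calc _ ≤ ∑ W : κ → ℤˣ, Fintype.card (κ → ℤˣ) *
        Real.exp ((x * √v * signForm a W) ^ 2 / 2) := by
        refine Finset.sum_le_sum fun W _ => ?_
        have := sum_exp_signForm_le a (x * signForm a W) hv
        simp_rw [← mul_assoc]
        refine this.trans_eq ?_
        congr 2
        rw [mul_pow (x * √v), mul_pow x (√v), Real.sq_sqrt hv0]
        ring
    _ ≤ _ := by
        rw [← Finset.mul_sum, pow_two, mul_assoc]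
        gcongr

/-- Replacing `exp` by `cosh` makes every term at least `1`, so that the excess over `1` can only
grow when a symmetric set is enlarged to all sign vectors. This is how conditioning on good signs is
paid for. -/
lemma sum_exp_eq_sum_cosh (G : Finset (κ → ℤˣ)) (hG : ∀ W ∈ G, -W ∈ G) (a : κ → ℝ) (c : ℝ) :
    ∑ W ∈ G, Real.exp (c * signForm a W) = ∑ W ∈ G, Real.cosh (c * signForm a W) := by
  have h : ∑ W ∈ G, Real.exp (c * signForm a W) = ∑ W ∈ G, Real.exp (-(c * signForm a W)) := by
    refine Finset.sum_nbij' (fun W => -W) (fun W => -W) hG hG (by simp) (by simp) ?_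
    intro W _
    simp [signForm_neg]
  have h2 : ∑ W ∈ G, Real.cosh (c * signForm a W) =
      ((∑ W ∈ G, Real.exp (c * signForm a W)) + ∑ W ∈ G, Real.exp (-(c * signForm a W))) / 2 := by
    rw [← Finset.sum_add_distrib, Finset.sum_div]
    simp_rw [Real.cosh_eq]
  linarith

/-- Exponential moment of a decoupled quadratic form in two sign vectors, restricted to a
symmetric set that contains at least half of all the sign vectors. -/
lemma sum_sum_exp_signForm_le_of_symm [DecidableEq κ] (G : Finset (κ → ℤˣ))
    (hG : ∀ W ∈ G, -W ∈ G) (hcard : (Fintype.card (κ → ℤˣ) : ℝ) ≤ 2 * G.card)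
    (a : κ → ℝ) {x v : ℝ} (hx0 : 0 ≤ x) (hv : ∑ k, a k ^ 2 ≤ v) (hx : x * v ≤ 1 / 4) :
    ∑ W ∈ G, ∑ W' ∈ G, Real.exp (x * (signForm a W * signForm a W')) ≤ 5 / 4 * G.card ^ 2 := by
  have hv0 : 0 ≤ v := le_trans (Finset.sum_nonneg fun _ _ => sq_nonneg _) hv
  have hxv : 0 ≤ x * v := by positivity
  have hxv2 : (x * v) ^ 2 ≤ 1 / 16 := by nlinarith
  have hcosh : ∀ H : Finset (κ → ℤˣ), (∀ W ∈ H, -W ∈ H) →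
      ∑ W ∈ H, ∑ W' ∈ H, Real.exp (x * (signForm a W * signForm a W')) =
      ∑ W ∈ H, ∑ W' ∈ H, (Real.cosh (x * (signForm a W * signForm a W')) - 1) + H.card ^ 2 := by
    intro H hH
    simp_rw [← mul_assoc, sum_exp_eq_sum_cosh H hH, Finset.sum_sub_distrib]
    simp
    ring
  have hall := sum_sum_exp_signForm_le a hv (x := x) (by linarith)
  rw [hcosh Finset.univ (by simp)] at hall
  -- The full excess is thus at most `1 / 16` of the square of the number of sign vectors, hence at
  -- most `4 / 16` of `G.card ^ 2`.
  have hsqrt : (√(1 - (x * v) ^ 2))⁻¹ ≤ 17 / 16 := by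
    rw [inv_le_comm₀ (Real.sqrt_pos.2 (by linarith)) (by norm_num)]
    exact Real.le_sqrt_of_sq_le (by norm_num; linarith)
  rw [hcosh G hG]
  have hsub : ∑ W ∈ G, ∑ W' ∈ G, (Real.cosh (x * (signForm a W * signForm a W')) - 1) ≤
      ∑ W : κ → ℤˣ, ∑ W' : κ → ℤˣ, (Real.cosh (x * (signForm a W * signForm a W')) - 1) := by
    have hnn : ∀ y : ℝ, 0 ≤ Real.cosh y - 1 := fun y => by linarith [Real.one_le_cosh y]
    calc _ ≤ ∑ W ∈ G, ∑ W' : κ → ℤˣ, (Real.cosh (x * (signForm a W * signForm a W')) - 1) :=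
          Finset.sum_le_sum fun W _ => Finset.sum_le_sum_of_subset_of_nonneg
            (Finset.subset_univ _) fun _ _ _ => hnn _
      _ ≤ _ := Finset.sum_le_sum_of_subset_of_nonneg (Finset.subset_univ _) fun _ _ _ =>
            Finset.sum_nonneg fun _ _ => hnn _
  simp only [Finset.card_univ] at hall
  have hN : (0 : ℝ) ≤ Fintype.card (κ → ℤˣ) := by positivity
  nlinarith [mul_le_mul_of_nonneg_left hsqrt (sq_nonneg (Fintype.card (κ → ℤˣ) : ℝ))]

end Signs

/-! ### Most sign matrices have operator norm at most `8 √m`. -/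

section OperatorNorm

lemma sum_Icc_pow_natAbs (K : ℕ) :
    ∑ k ∈ Finset.Icc (-(K : ℤ)) K, (3 / 5 : ℝ) ^ k.natAbs = 4 - 5 * (3 / 5) ^ (K + 1) := by
  induction K with
  | zero => norm_num
  | succ K ih =>
    have h : Finset.Icc (-((K + 1 : ℕ) : ℤ)) ((K + 1 : ℕ) : ℤ) =
        insert (-((K + 1 : ℕ) : ℤ)) (insert ((K + 1 : ℕ) : ℤ) (Finset.Icc (-(K : ℤ)) K)) := by
      ext x
      simp only [Finset.mem_Icc, Finset.mem_insert]
      omega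
    rw [h, Finset.sum_insert, Finset.sum_insert, ih, Int.natAbs_neg, Int.natAbs_natCast]
    · ring
    · simp
    · simp only [Finset.mem_insert, Finset.mem_Icc]
      omega

/-- Rounding is towards zero, so that it does not increase norms and the rounded vectors stay inside
the net. -/
lemma exists_int_truncation (x : ℝ) : ∃ z : ℤ, |(z : ℝ)| ≤ |x| ∧ |x - z| ≤ 1 := by
  rcases le_total 0 x with h | h
  · refine ⟨⌊x⌋, ?_, ?_⟩
    · rw [abs_of_nonneg h, abs_of_nonneg (by exact_mod_cast Int.floor_nonneg.2 h)]
      exact Int.floor_le x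
    · rw [abs_of_nonneg (by linarith [Int.floor_le x])]
      linarith [Int.lt_floor_add_one x]
  · refine ⟨⌈x⌉, ?_, ?_⟩
    · rw [abs_of_nonpos h, abs_of_nonpos (by exact_mod_cast Int.ceil_nonpos.2 h)]
      linarith [Int.le_ceil x]
    · rw [abs_of_nonpos (by linarith [Int.le_ceil x])]
      linarith [Int.ceil_lt_add_one x]

/-- The bilinear form `∑ W (j, k) u j v k` of a sign matrix `W`. -/
noncomputable def signBilin {m : ℕ} (W : Fin m × Fin m → ℤˣ) (u v : Fin m → ℝ) : ℝ :=
  signForm (fun p => u p.1 * v p.2) W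

variable {m : ℕ}

lemma signBilin_add_left (W : Fin m × Fin m → ℤˣ) (u u' v : Fin m → ℝ) :
    signBilin W (u + u') v = signBilin W u v + signBilin W u' v := by
  simp only [signBilin, signForm, ← Finset.sum_add_distrib, Pi.add_apply]
  exact Finset.sum_congr rfl fun _ _ => by ring

lemma signBilin_add_right (W : Fin m × Fin m → ℤˣ) (u v v' : Fin m → ℝ) :
    signBilin W u (v + v') = signBilin W u v + signBilin W u v' := by
  simp only [signBilin, signForm, ← Finset.sum_add_distrib, Pi.add_apply]
  exact Finset.sum_congr rfl fun _ _ => by ring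

lemma signBilin_smul_left (W : Fin m × Fin m → ℤˣ) (c : ℝ) (u v : Fin m → ℝ) :
    signBilin W (c • u) v = c * signBilin W u v := by
  simp only [signBilin, signForm, Finset.mul_sum, Pi.smul_apply, smul_eq_mul]
  exact Finset.sum_congr rfl fun _ _ => by ring

lemma signBilin_smul_right (W : Fin m × Fin m → ℤˣ) (c : ℝ) (u v : Fin m → ℝ) :
    signBilin W u (c • v) = c * signBilin W u v := by
  simp only [signBilin, signForm, Finset.mul_sum, Pi.smul_apply, smul_eq_mul]
  exact Finset.sum_congr rfl fun _ _ => by ring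

/-- The sign matrix `W` has operator norm at most `S`. -/
def SignOpBound (S : ℝ) (W : Fin m × Fin m → ℤˣ) : Prop :=
  ∀ u v : Fin m → ℝ, ∑ j, u j ^ 2 ≤ 1 → ∑ j, v j ^ 2 ≤ 1 → signBilin W u v ≤ S

lemma SignOpBound.neg {S : ℝ} {W : Fin m × Fin m → ℤˣ} (h : SignOpBound S W) :
    SignOpBound S (-W) := by
  intro u v hu hv
  have := h ((-1 : ℝ) • u) v (by simpa using hu) hv
  rw [signBilin_smul_left] at this
  rw [signBilin, signForm_neg]
  simpa [signBilin] using this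

lemma sum_sq_smul (c : ℝ) (u : Fin m → ℝ) : ∑ j, (c • u) j ^ 2 = c ^ 2 * ∑ j, u j ^ 2 := by
  simp [Finset.mul_sum, mul_pow]

/-- Homogeneity followed by `2ab ≤ a² + b²`; this additive form matches the quadratic form of the
block matrix. -/
lemma SignOpBound.two_mul_le {S : ℝ} {W : Fin m × Fin m → ℤˣ} (h : SignOpBound S W)
    (u v : Fin m → ℝ) : 2 * signBilin W u v ≤ S * (∑ j, u j ^ 2 + ∑ j, v j ^ 2) := by
  have key : ∀ w : Fin m → ℝ, ∑ j, w j ^ 2 ≤ 0 → w = 0 := by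
    intro w hw
    have h0 := (Finset.sum_eq_zero_iff_of_nonneg fun j _ => sq_nonneg (w j)).1
      (le_antisymm hw (Finset.sum_nonneg fun j _ => sq_nonneg (w j)))
    funext j
    simpa using h0 j (Finset.mem_univ _)
  have hS : 0 ≤ S := by simpa [signBilin, signForm] using h 0 0 (by simp) (by simp)
  have hnn : ∀ w : Fin m → ℝ, 0 ≤ ∑ j, w j ^ 2 := fun w => Finset.sum_nonneg fun j _ => sq_nonneg _
  rcases (hnn u).eq_or_lt' with hu | hu
  · rw [key u hu.le]
    simpa [signBilin, signForm] using mul_nonneg hS (hnn v)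
  rcases (hnn v).eq_or_lt' with hv | hv
  · rw [key v hv.le]
    simpa [signBilin, signForm] using mul_nonneg hS (hnn u)
  have hu' := Real.sqrt_pos.2 hu
  have hv' := Real.sqrt_pos.2 hv
  have h1 := h ((√(∑ j, u j ^ 2))⁻¹ • u) ((√(∑ j, v j ^ 2))⁻¹ • v)
    (by rw [sum_sq_smul, inv_pow, Real.sq_sqrt hu.le, inv_mul_cancel₀ hu.ne'])
    (by rw [sum_sq_smul, inv_pow, Real.sq_sqrt hv.le, inv_mul_cancel₀ hv.ne'])
  rw [signBilin_smul_left, signBilin_smul_right, inv_mul_le_iff₀ hu', inv_mul_le_iff₀ hv'] at h1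
  have hsu := Real.sq_sqrt hu.le
  have hsv := Real.sq_sqrt hv.le
  set a := √(∑ j, u j ^ 2)
  set b := √(∑ j, v j ^ 2)
  rw [← hsu, ← hsv]
  nlinarith [mul_nonneg hS (sq_nonneg (a - b))]

/-- A crude bound, needed only so that the supremum over the unit balls is finite. -/
lemma signBilin_le_card (W : Fin m × Fin m → ℤˣ) (u v : Fin m → ℝ)
    (hu : ∑ j, u j ^ 2 ≤ 1) (hv : ∑ j, v j ^ 2 ≤ 1) :
    signBilin W u v ≤ Fintype.card (Fin m × Fin m) := by
  have key : ∀ w : Fin m → ℝ, ∑ j, w j ^ 2 ≤ 1 → ∀ j, |w j| ≤ 1 := by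
    intro w hw j
    rw [← sq_le_one_iff_abs_le_one]
    exact (Finset.single_le_sum (f := fun j => w j ^ 2) (fun j _ => sq_nonneg _)
      (Finset.mem_univ j)).trans hw
  calc signBilin W u v ≤ ∑ _p : Fin m × Fin m, (1 : ℝ) := by
        refine Finset.sum_le_sum fun p _ => (le_abs_self _).trans ?_
        rw [abs_mul, abs_mul]
        have h1 : |((W p : ℤ) : ℝ)| = 1 := by
          rcases Int.units_eq_one_or (W p) with h | h <;> simp [h]
        rw [h1, mul_one]
        exact mul_le_one₀ (key u hu _) (abs_nonneg _) (key v hv _)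
    _ = _ := by simp

/-- Integer vectors that form, after scaling, a net of the unit ball. -/
noncomputable def intNet (m : ℕ) : Finset (Fin m → ℤ) :=
  (Fintype.piFinset fun _ => Finset.Icc (-((4 * m : ℕ) : ℤ)) ((4 * m : ℕ) : ℤ)).filter
    fun z => ∑ j, (z j).natAbs ≤ 4 * m ∧ ∑ j, z j ^ 2 ≤ 16 * m

/-- An exponential weighting count: on the net the weight `(5/3)^(4m) ∏ (3/5)^|z j|` is at least
`1`, while its sum over the box factors into geometric sums below `(1 + 3/5) / (1 - 3/5) = 4`. -/
lemma card_intNet_le (m : ℕ) : ((intNet m).card : ℝ) ≤ (2500 / 81) ^ m := by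
  have h1 : ∀ z ∈ intNet m, (1 : ℝ) ≤ (5 / 3) ^ (4 * m) * ∏ j, (3 / 5 : ℝ) ^ (z j).natAbs := by
    intro z hz
    have hz' := (Finset.mem_filter.1 hz).2.1
    rw [Finset.prod_pow_eq_pow_sum]
    calc (1 : ℝ) = (5 / 3) ^ (4 * m) * (3 / 5) ^ (4 * m) := by rw [← mul_pow]; norm_num
      _ ≤ _ := by
        gcongr ?_ * ?_
        exact pow_le_pow_of_le_one (by norm_num) (by norm_num) hz'
  calc ((intNet m).card : ℝ) = ∑ z ∈ intNet m, 1 := by simp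
    _ ≤ ∑ z ∈ intNet m, (5 / 3) ^ (4 * m) * ∏ j, (3 / 5 : ℝ) ^ (z j).natAbs :=
        Finset.sum_le_sum h1
    _ ≤ ∑ z ∈ Fintype.piFinset fun _ : Fin m =>
          Finset.Icc (-((4 * m : ℕ) : ℤ)) ((4 * m : ℕ) : ℤ),
          (5 / 3) ^ (4 * m) * ∏ j, (3 / 5 : ℝ) ^ (z j).natAbs :=
        Finset.sum_le_sum_of_subset_of_nonneg (Finset.filter_subset _ _)
          fun _ _ _ => by positivity
    _ = (5 / 3) ^ (4 * m) * (4 - 5 * (3 / 5) ^ (4 * m + 1)) ^ m := by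
        rw [← Finset.mul_sum, ← Finset.prod_univ_sum
          (f := fun (_ : Fin m) (k : ℤ) => (3 / 5 : ℝ) ^ k.natAbs)]
        simp_rw [sum_Icc_pow_natAbs]
        simp
    _ ≤ (5 / 3) ^ (4 * m) * 4 ^ m := by
        have h2 : (3 / 5 : ℝ) ^ (4 * m + 1) ≤ 3 / 5 := by
          simpa using pow_le_pow_of_le_one (a := (3 / 5 : ℝ)) (by norm_num) (by norm_num)
            (show 1 ≤ 4 * m + 1 by omega)
        have h3 : (0 : ℝ) ≤ (3 / 5 : ℝ) ^ (4 * m + 1) := by positivity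
        gcongr <;> linarith
    _ = _ := by rw [pow_mul, ← mul_pow]; norm_num

/-- Truncating `4 √m u` coordinatewise errs by at most `1` in each coordinate, hence by at most `1 /
4` in norm after rescaling. Cauchy–Schwarz gives the `ℓ¹` bound that membership requires. -/
lemma exists_intNet_near (hm : 0 < m) (u : Fin m → ℝ) (hu : ∑ j, u j ^ 2 ≤ 1) :
    ∃ z ∈ intNet m,
      ∑ j, ((4 : ℝ) • (u - (4 * √m)⁻¹ • fun j => (z j : ℝ))) j ^ 2 ≤ 1 := by
  have hm' : (0 : ℝ) < m := by exact_mod_cast hm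
  have hs := Real.sqrt_pos.2 hm'
  have hsq := Real.sq_sqrt hm'.le
  choose z hz1 hz2 using fun j => exists_int_truncation (4 * √m * u j)
  have hsum2 : ∑ j, (z j : ℝ) ^ 2 ≤ 16 * m := by
    calc ∑ j, (z j : ℝ) ^ 2 ≤ ∑ j, (4 * √m * u j) ^ 2 :=
          Finset.sum_le_sum fun j _ => sq_le_sq.2 (hz1 j)
      _ = 16 * m * ∑ j, u j ^ 2 := by
          rw [Finset.mul_sum]
          refine Finset.sum_congr rfl fun j _ => ?_
          rw [mul_pow, mul_pow, hsq]
          norm_num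
      _ ≤ 16 * m * 1 := by gcongr
      _ = _ := mul_one _
  have hsum1 : ∑ j, |(z j : ℝ)| ≤ 4 * m := by
    have h := sq_sum_le_card_mul_sum_sq (s := Finset.univ) (f := fun j => |(z j : ℝ)|)
    simp only [sq_abs, Finset.card_univ, Fintype.card_fin] at h
    refine abs_le_of_sq_le_sq' ?_ (by positivity) |>.2
    nlinarith
  have hnat : ∑ j, (z j).natAbs ≤ 4 * m := by
    have : ((∑ j, (z j).natAbs : ℕ) : ℝ) ≤ ((4 * m : ℕ) : ℝ) := by
      push_cast
      simpa [Nat.cast_natAbs] using hsum1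
    exact_mod_cast this
  refine ⟨z, ?_, ?_⟩
  · refine Finset.mem_filter.2 ⟨?_, hnat, by exact_mod_cast hsum2⟩
    refine Fintype.mem_piFinset.2 fun j => ?_
    have := (Finset.single_le_sum (f := fun j => (z j).natAbs) (fun _ _ => Nat.zero_le _)
      (Finset.mem_univ j)).trans hnat
    simp only [Finset.mem_Icc]
    omega
  · have h1 : ∀ j, ((4 : ℝ) • (u - (4 * √m)⁻¹ • fun j => (z j : ℝ))) j ^ 2 ≤ (m : ℝ)⁻¹ := by
      intro j
      have h2 : ((4 : ℝ) • (u - (4 * √m)⁻¹ • fun j => (z j : ℝ))) j =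
          (√m)⁻¹ * (4 * √m * u j - z j) := by
        simp only [Pi.smul_apply, Pi.sub_apply, smul_eq_mul]
        field_simp
      rw [h2, mul_pow, inv_pow, hsq]
      have := (sq_le_one_iff_abs_le_one _).2 (hz2 j)
      exact mul_le_of_le_one_right (by positivity) this
    calc _ ≤ ∑ _j : Fin m, (m : ℝ)⁻¹ := Finset.sum_le_sum fun j _ => h1 j
      _ = 1 := by simp [hm'.ne']

lemma sum_sq_intNet_le (hm : 0 < m) {z : Fin m → ℤ} (hz : z ∈ intNet m) :
    ∑ j, ((4 * √m)⁻¹ • fun j => (z j : ℝ)) j ^ 2 ≤ 1 := by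
  have hm' : (0 : ℝ) < m := by exact_mod_cast hm
  have h : ∑ j, (z j : ℝ) ^ 2 ≤ 16 * m := by exact_mod_cast (Finset.mem_filter.1 hz).2.2
  rw [sum_sq_smul, inv_pow, mul_pow, Real.sq_sqrt hm'.le, inv_mul_le_iff₀ (by positivity)]
  linarith

lemma signOpBound_of_intNet (hm : 0 < m) (W : Fin m × Fin m → ℤˣ)
    (h : ∀ z ∈ intNet m, ∀ z' ∈ intNet m,
      signBilin W (fun j => (z j : ℝ)) (fun j => (z' j : ℝ)) ≤ 64 * m * √m) :
    SignOpBound (8 * √m) W := by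
  have hm' : (0 : ℝ) < m := by exact_mod_cast hm
  have hs := Real.sqrt_pos.2 hm'
  have hsq := Real.mul_self_sqrt hm'.le
  set A : Set ℝ := {x | ∃ u v : Fin m → ℝ, ∑ j, u j ^ 2 ≤ 1 ∧ ∑ j, v j ^ 2 ≤ 1 ∧
    x = signBilin W u v} with hA
  have hbdd : BddAbove A := by
    refine ⟨Fintype.card (Fin m × Fin m), ?_⟩
    rintro x ⟨u, v, hu, hv, rfl⟩
    exact signBilin_le_card W u v hu hv
  have hne : A.Nonempty := ⟨_, 0, 0, by simp, by simp, rfl⟩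
  have hle : ∀ u v : Fin m → ℝ, ∑ j, u j ^ 2 ≤ 1 → ∑ j, v j ^ 2 ≤ 1 → signBilin W u v ≤ sSup A :=
    fun u v hu hv => le_csSup hbdd ⟨u, v, hu, hv, rfl⟩
  -- With net points `p`, `q` near `u`, `v`, the form splits into its value at `(p, q)`, at most `4
  -- √m`, and two errors of at most a quarter of the supremum each.
  have hstep : sSup A ≤ 4 * √m + sSup A / 2 := by
    refine csSup_le hne ?_
    rintro x ⟨u, v, hu, hv, rfl⟩
    obtain ⟨z, hz, hzu⟩ := exists_intNet_near hm u hu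
    obtain ⟨z', hz', hzv⟩ := exists_intNet_near hm v hv
    have h1 := hle _ v hzu hv
    have h2 := hle _ _ (sum_sq_intNet_le hm hz) hzv
    have h3 := h z hz z' hz'
    set p : Fin m → ℝ := (4 * √m)⁻¹ • fun j => (z j : ℝ) with hp
    set q : Fin m → ℝ := (4 * √m)⁻¹ • fun j => (z' j : ℝ) with hq
    have h4 : signBilin W p q ≤ 4 * √m := by
      rw [hp, hq, signBilin_smul_left, signBilin_smul_right, inv_mul_le_iff₀ (by positivity),
        inv_mul_le_iff₀ (by positivity)]
      refine h3.trans_eq ?_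
      linear_combination (-64 * √m) * hsq
    rw [signBilin_smul_left] at h1
    rw [signBilin_smul_right] at h2
    have e1 : signBilin W u v = signBilin W p v + signBilin W (u - p) v := by
      rw [← signBilin_add_left]; simp
    have e2 : signBilin W p v = signBilin W p q + signBilin W p (v - q) := by
      rw [← signBilin_add_right]; simp
    linarith
  intro u v hu hv
  linarith [hle u v hu hv]

open Classical in
/-- The sign matrices with operator norm at most `8 √m`. -/
noncomputable def goodSigns (m : ℕ) : Finset (Fin m × Fin m → ℤˣ) :=
  Finset.univ.filter (SignOpBound (8 * √m))

lemma mem_goodSigns {W : Fin m × Fin m → ℤˣ} : W ∈ goodSigns m ↔ SignOpBound (8 * √m) W := by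
  simp [goodSigns]

/-- The Chernoff parameter is optimal: threshold `64 m √m` divided by variance proxy `(16 m)²`. The
exponent is `8 m - 16 m`. -/
lemma sum_exp_signBilin_le (hm : 0 < m) {z z' : Fin m → ℤ} (hz : z ∈ intNet m)
    (hz' : z' ∈ intNet m) :
    ∑ W : Fin m × Fin m → ℤˣ, Real.exp ((4 * √m)⁻¹ *
      (signBilin W (fun j => (z j : ℝ)) (fun j => (z' j : ℝ)) - 64 * m * √m)) ≤
      Fintype.card (Fin m × Fin m → ℤˣ) * Real.exp (-8 * m) := by
  have hm' : (0 : ℝ) < m := by exact_mod_cast hm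
  have hs := Real.sqrt_pos.2 hm'
  have hsq := Real.mul_self_sqrt hm'.le
  have h : ∑ j, (z j : ℝ) ^ 2 ≤ 16 * m := by exact_mod_cast (Finset.mem_filter.1 hz).2.2
  have h' : ∑ j, (z' j : ℝ) ^ 2 ≤ 16 * m := by exact_mod_cast (Finset.mem_filter.1 hz').2.2
  have hv : ∑ p : Fin m × Fin m, ((z p.1 : ℝ) * (z' p.2 : ℝ)) ^ 2 ≤ (16 * m) * (16 * m) := by
    simp_rw [mul_pow]
    rw [Fintype.sum_prod_type]
    dsimp only
    rw [← Finset.sum_mul_sum]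
    exact mul_le_mul h h' (Finset.sum_nonneg fun _ _ => sq_nonneg _) (by positivity)
  have := sum_exp_signForm_le _ ((4 * √m)⁻¹) hv
  simp_rw [mul_sub, Real.exp_sub, ← Finset.sum_div]
  rw [div_le_iff₀ (Real.exp_pos _)]
  refine this.trans_eq ?_
  rw [mul_assoc (_ : ℝ) (Real.exp _), ← Real.exp_add]
  congr 2
  rw [inv_pow, mul_pow, Real.sq_sqrt hm'.le]
  field_simp
  ring

lemma card_goodSigns (hm : 0 < m) :
    (Fintype.card (Fin m × Fin m → ℤˣ) : ℝ) ≤ 2 * (goodSigns m).card := by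
  classical
  set N : ℝ := (Fintype.card (Fin m × Fin m → ℤˣ) : ℝ) with hN
  have hN0 : 0 ≤ N := by positivity
  have hbad : ∀ W ∈ (goodSigns m)ᶜ, (1 : ℝ) ≤ ∑ z ∈ intNet m, ∑ z' ∈ intNet m,
      Real.exp ((4 * √m)⁻¹ *
        (signBilin W (fun j => (z j : ℝ)) (fun j => (z' j : ℝ)) - 64 * m * √m)) := by
    intro W hW
    rw [Finset.mem_compl, mem_goodSigns] at hW
    have : ∃ z ∈ intNet m, ∃ z' ∈ intNet m,
        64 * m * √m < signBilin W (fun j => (z j : ℝ)) (fun j => (z' j : ℝ)) := by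
      by_contra! hcon
      exact hW (signOpBound_of_intNet hm W hcon)
    obtain ⟨z, hz, z', hz', hlt⟩ := this
    calc (1 : ℝ) ≤ Real.exp ((4 * √m)⁻¹ *
        (signBilin W (fun j => (z j : ℝ)) (fun j => (z' j : ℝ)) - 64 * m * √m)) :=
          Real.one_le_exp (mul_nonneg (by positivity) (by linarith))
      _ ≤ ∑ z' ∈ intNet m, Real.exp ((4 * √m)⁻¹ *
        (signBilin W (fun j => (z j : ℝ)) (fun j => (z' j : ℝ)) - 64 * m * √m)) :=
          Finset.single_le_sum (f := fun z' : Fin m → ℤ => Real.exp ((4 * √m)⁻¹ *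
            (signBilin W (fun j => (z j : ℝ)) (fun j => (z' j : ℝ)) - 64 * m * √m)))
            (fun _ _ => (Real.exp_pos _).le) hz'
      _ ≤ _ := Finset.single_le_sum (f := fun z : Fin m → ℤ => ∑ z' ∈ intNet m,
            Real.exp ((4 * √m)⁻¹ *
            (signBilin W (fun j => (z j : ℝ)) (fun j => (z' j : ℝ)) - 64 * m * √m)))
            (fun _ _ => Finset.sum_nonneg fun _ _ => (Real.exp_pos _).le) hz
  have hcard : (((goodSigns m)ᶜ).card : ℝ) ≤ N / 2 := by
    calc (((goodSigns m)ᶜ).card : ℝ) = ∑ W ∈ (goodSigns m)ᶜ, (1 : ℝ) := by simp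
      _ ≤ ∑ W ∈ (goodSigns m)ᶜ, ∑ z ∈ intNet m, ∑ z' ∈ intNet m, Real.exp ((4 * √m)⁻¹ *
        (signBilin W (fun j => (z j : ℝ)) (fun j => (z' j : ℝ)) - 64 * m * √m)) :=
          Finset.sum_le_sum hbad
      _ ≤ ∑ W, ∑ z ∈ intNet m, ∑ z' ∈ intNet m, Real.exp ((4 * √m)⁻¹ *
        (signBilin W (fun j => (z j : ℝ)) (fun j => (z' j : ℝ)) - 64 * m * √m)) :=
          Finset.sum_le_sum_of_subset_of_nonneg (Finset.subset_univ _) fun _ _ _ =>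
            Finset.sum_nonneg fun _ _ => Finset.sum_nonneg fun _ _ => (Real.exp_pos _).le
      _ = ∑ z ∈ intNet m, ∑ z' ∈ intNet m, ∑ W, Real.exp ((4 * √m)⁻¹ *
        (signBilin W (fun j => (z j : ℝ)) (fun j => (z' j : ℝ)) - 64 * m * √m)) := by
          rw [Finset.sum_comm]
          exact Finset.sum_congr rfl fun _ _ => Finset.sum_comm
      _ ≤ ∑ z ∈ intNet m, ∑ z' ∈ intNet m, N * Real.exp (-8 * m) :=
          Finset.sum_le_sum fun z hz => Finset.sum_le_sum fun z' hz' =>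
            sum_exp_signBilin_le hm hz hz'
      _ = ((intNet m).card : ℝ) ^ 2 * (N * Real.exp (-8 * m)) := by
          simp
          ring
      _ ≤ ((2500 / 81) ^ m) ^ 2 * (N * Real.exp (-8 * m)) := by
          gcongr
          exact card_intNet_le m
      _ = N * ((2500 / 81) ^ 2 * Real.exp (-8)) ^ m := by
          rw [mul_pow, ← Real.exp_nat_mul, ← pow_mul, ← pow_mul, mul_comm m 2,
            mul_comm (m : ℝ) (-8)]
          ring
      -- The union bound over pairs of net points closes because `(2500 / 81)² ≈ 953` is less than
      -- half of `exp 8 ≈ 2981`.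
      _ ≤ N * (1 / 2) ^ m := by
          gcongr
          have h1 : (2.7 : ℝ) ^ 8 ≤ Real.exp 8 := by
            rw [show (8 : ℝ) = (8 : ℕ) * 1 by norm_num, Real.exp_nat_mul]
            exact pow_le_pow_left₀ (by norm_num) (by linarith [Real.exp_one_gt_d9]) 8
          rw [Real.exp_neg, ← div_eq_mul_inv, div_le_iff₀ (Real.exp_pos _)]
          norm_num at h1 ⊢
          linarith
      _ ≤ N * (1 / 2) := by
          gcongr
          simpa using pow_le_pow_of_le_one (a := (1 / 2 : ℝ)) (by norm_num) (by norm_num) hm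
      _ = N / 2 := by ring
  have htot : ((goodSigns m).card : ℝ) + ((goodSigns m)ᶜ).card = N := by
    rw [hN]
    exact_mod_cast Finset.card_add_card_compl _
  linarith

end OperatorNorm

/-! ### The second moment method for mixtures of product laws. -/

section Mixture

lemma ENNReal.tsum_pi_prod {n : ℕ} {Y : Fin n → Type*} (f : ∀ i, Y i → ℝ≥0∞) :
    ∑' y : (∀ i, Y i), ∏ i, f i (y i) = ∏ i, ∑' y, f i y := by
  induction n with
  | zero => simp
  | succ n ih =>
    rw [← (Fin.consEquiv Y).tsum_eq, ENNReal.tsum_prod', Fin.prod_univ_succ,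
      ← ih (Y := fun i => Y i.succ) (fun i => f i.succ), ← ENNReal.tsum_mul_right]
    refine tsum_congr fun y => ?_
    rw [← ENNReal.tsum_mul_left]
    refine tsum_congr fun z => ?_
    rw [Fin.prod_univ_succ]
    simp [Fin.consEquiv]

variable {κ : Type*} [Fintype κ]

lemma sq_signForm_le (a : κ → ℝ) (W : κ → ℤˣ) :
    signForm a W ^ 2 ≤ Fintype.card κ * ∑ k, a k ^ 2 := by
  have h := sq_sum_le_card_mul_sum_sq (s := Finset.univ) (f := fun k => a k * ((W k : ℤ) : ℝ))
  refine h.trans_eq ?_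
  simp only [Finset.card_univ]
  congr 1
  refine Finset.sum_congr rfl fun k _ => ?_
  rcases Int.units_eq_one_or (W k) with h | h <;> simp [h]

lemma abs_signForm_mul_le (a : κ → ℝ) {v : ℝ} (hv : ∑ k, a k ^ 2 ≤ v) (W W' : κ → ℤˣ) :
    |signForm a W * signForm a W'| ≤ Fintype.card κ * v := by
  have h1 := (sq_signForm_le a W).trans (mul_le_mul_of_nonneg_left hv (by positivity))
  have h2 := (sq_signForm_le a W').trans (mul_le_mul_of_nonneg_left hv (by positivity))
  rw [abs_le]
  constructor <;> nlinarith [sq_nonneg (signForm a W + signForm a W'),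
    sq_nonneg (signForm a W - signForm a W')]

lemma hasSum_mul_signForm {Y : Type*} {t : Y → ℝ} {a : Y → κ → ℝ}
    (h : ∀ k, HasSum (fun y => t y * a y k) 0) (W : κ → ℤˣ) :
    HasSum (fun y => t y * signForm (a y) W) 0 := by
  have := hasSum_sum (s := Finset.univ) fun k _ => (h k).mul_right ((W k : ℤ) : ℝ)
  simpa [signForm, Finset.mul_sum, mul_assoc] using this

lemma summable_mul_signForm_mul {Y : Type*} {t : Y → ℝ} (ht : ∀ y, 0 ≤ t y) (hsum : Summable t)
    {a : Y → κ → ℝ} {v : ℝ} (hv : ∀ y, ∑ k, a y k ^ 2 ≤ v) (W W' : κ → ℤˣ) :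
    Summable (fun y => t y * (signForm (a y) W * signForm (a y) W')) := by
  refine Summable.of_norm_bounded (hsum.mul_right (Fintype.card κ * v)) fun y => ?_
  rw [norm_mul, Real.norm_eq_abs, Real.norm_eq_abs, abs_of_nonneg (ht y)]
  exact mul_le_mul_of_nonneg_left (abs_signForm_mul_le _ (hv y) W W') (ht y)

/-- Second moment of the averaged likelihood ratio of product laws whose factors are sign-linear
perturbations of a fixed law. -/
lemma sum_sum_prod_one_add_le [DecidableEq κ] {n : ℕ} {Y : Fin n → Type*} (G : Finset (κ → ℤˣ))
    (hG : ∀ W ∈ G, -W ∈ G) (hcard : (Fintype.card (κ → ℤˣ) : ℝ) ≤ 2 * G.card)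
    (t : ∀ i, Y i → ℝ) (ht : ∀ i y, 0 ≤ t i y) (hsum : ∀ i, HasSum (t i) 1)
    (a : ∀ i, Y i → κ → ℝ) {v : ℝ} (hv : ∀ i y, ∑ k, a i y k ^ 2 ≤ v) (hnv : n * v ≤ 1 / 4)
    (hpos : ∀ W ∈ G, ∀ W' ∈ G, ∀ i,
      0 ≤ 1 + ∑' y, t i y * (signForm (a i y) W * signForm (a i y) W')) :
    ∑ W ∈ G, ∑ W' ∈ G, ∏ i, (1 + ∑' y, t i y * (signForm (a i y) W * signForm (a i y) W')) ≤
      5 / 4 * (G.card : ℝ) ^ 2 := by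
  set A : (κ → ℤˣ) → (κ → ℤˣ) → Fin n → ℝ := fun W W' i =>
    ∑' y, t i y * (signForm (a i y) W * signForm (a i y) W') with hA
  have hAsum : ∀ W W' i, HasSum (fun y => t i y * (signForm (a i y) W * signForm (a i y) W'))
      (A W W' i) := fun W W' i =>
    (summable_mul_signForm_mul (ht i) (hsum i).summable (hv i) W W').hasSum
  have h1 : ∀ W ∈ G, ∀ W' ∈ G, ∏ i, (1 + A W W' i) ≤ Real.exp (∑ i, A W W' i) := by
    intro W hW W' hW'
    rw [Real.exp_sum]
    exact Finset.prod_le_prod (fun i _ => hpos W hW W' hW' i)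
      fun i _ => by linarith [Real.add_one_le_exp (A W W' i)]
  refine (Finset.sum_le_sum fun W hW => Finset.sum_le_sum fun W' hW' => h1 W hW W' hW').trans ?_
  rcases Nat.eq_zero_or_pos n with rfl | hn
  · simp
    nlinarith [sq_nonneg (G.card : ℝ)]
  have hn' : (0 : ℝ) < n := by exact_mod_cast hn
  -- Jensen's inequality in tangent form: bound `exp x` below by its tangent at `b = ∑ i, A W W' i`,
  -- with `x` equal to `n` times the product of sign forms, and average over `y`. Summed over `i`,
  -- the terms `n A - b` cancel.
  have h2 : ∀ i, ∑ W ∈ G, ∑ W' ∈ G, Real.exp (∑ i, A W W' i) *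
      (1 + n * A W W' i - ∑ i, A W W' i) ≤ 5 / 4 * (G.card : ℝ) ^ 2 := by
    intro i
    have hL : HasSum (fun y => ∑ W ∈ G, ∑ W' ∈ G, Real.exp (∑ i, A W W' i) *
        (t i y + n * (t i y * (signForm (a i y) W * signForm (a i y) W')) -
          t i y * ∑ i, A W W' i))
        (∑ W ∈ G, ∑ W' ∈ G, Real.exp (∑ i, A W W' i) *
        (1 + n * A W W' i - 1 * ∑ i, A W W' i)) :=
      hasSum_sum fun W _ => hasSum_sum fun W' _ =>
        ((((hsum i).add ((hAsum W W' i).mul_left _)).sub ((hsum i).mul_right _)).mul_left _)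
    have hR : HasSum (fun y => t i y * (5 / 4 * (G.card : ℝ) ^ 2)) (1 * (5 / 4 * (G.card : ℝ) ^ 2)) :=
      (hsum i).mul_right _
    simp only [one_mul] at hL hR
    refine hasSum_le (fun y => ?_) hL hR
    have h3 := sum_sum_exp_signForm_le_of_symm G hG hcard (a i y) (Nat.cast_nonneg n) (hv i y) hnv
    refine le_trans ?_ (mul_le_mul_of_nonneg_left h3 (ht i y))
    rw [Finset.mul_sum]
    refine Finset.sum_le_sum fun W _ => ?_
    rw [Finset.mul_sum]
    refine Finset.sum_le_sum fun W' _ => ?_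
    set b := ∑ i, A W W' i
    set x := n * (signForm (a i y) W * signForm (a i y) W')
    have h4 : Real.exp b * (1 + x - b) ≤ Real.exp x := by
      have := mul_le_mul_of_nonneg_left (Real.add_one_le_exp (x - b)) (Real.exp_pos b).le
      rw [← Real.exp_add] at this
      rw [show b + (x - b) = x by ring] at this
      linarith
    calc _ = t i y * (Real.exp b * (1 + x - b)) := by simp only [x]; ring
      _ ≤ _ := mul_le_mul_of_nonneg_left h4 (ht i y)
  have h5 := Finset.sum_le_sum fun i (_ : i ∈ (Finset.univ : Finset (Fin n))) => h2 i
  rw [Finset.sum_comm] at h5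
  simp only [Finset.sum_const, Finset.card_univ, Fintype.card_fin, nsmul_eq_mul] at h5
  have h6 : ∑ W ∈ G, ∑ i : Fin n, ∑ W' ∈ G, Real.exp (∑ i, A W W' i) *
      (1 + n * A W W' i - ∑ i, A W W' i) =
      n * ∑ W ∈ G, ∑ W' ∈ G, Real.exp (∑ i, A W W' i) := by
    rw [Finset.mul_sum]
    refine Finset.sum_congr rfl fun W _ => ?_
    rw [Finset.sum_comm, Finset.mul_sum]
    refine Finset.sum_congr rfl fun W' _ => ?_
    rw [← Finset.mul_sum, Finset.sum_sub_distrib, Finset.sum_add_distrib, ← Finset.mul_sum]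
    simp
    ring
  rw [h6] at h5
  exact le_of_mul_le_mul_left h5 hn'

/-- Averaged over the perturbations, an event is at most `5 / 16` more likely than under the
unperturbed product law. -/
lemma sum_tsum_prod_le [DecidableEq κ] {n : ℕ} {Y : Fin n → Type*} (G : Finset (κ → ℤˣ))
    (hG : ∀ W ∈ G, -W ∈ G) (hcard : (Fintype.card (κ → ℤˣ) : ℝ) ≤ 2 * G.card)
    (t : ∀ i, Y i → ℝ) (ht : ∀ i y, 0 ≤ t i y) (hsum : ∀ i, HasSum (t i) 1)
    (a : ∀ i, Y i → κ → ℝ) {v : ℝ} (hv : ∀ i y, ∑ k, a i y k ^ 2 ≤ v) (hnv : n * v ≤ 1 / 4)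
    (hmean : ∀ i k, HasSum (fun y => t i y * a i y k) 0)
    (hpos : ∀ W ∈ G, ∀ i y, 0 ≤ t i y * (1 + signForm (a i y) W))
    (D : (∀ i, Y i) → Prop) [DecidablePred D] :
    ∑ W ∈ G, ∑' y, (if D y then
        ENNReal.ofReal (∏ i, (t i (y i) * (1 + signForm (a i (y i)) W))) else 0) ≤
      G.card * ((∑' y, if D y then ENNReal.ofReal (∏ i, t i (y i)) else 0) +
        ENNReal.ofReal (5 / 16)) := by
  have hN : (0 : ℝ) < G.card := by
    have : (0 : ℝ) < Fintype.card (κ → ℤˣ) := by exact_mod_cast Fintype.card_pos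
    linarith
  have hpos2 : ∀ W ∈ G, ∀ W' ∈ G, ∀ i y,
      0 ≤ t i y * (1 + signForm (a i y) W) * (1 + signForm (a i y) W') := by
    intro W hW W' hW' i y
    rcases (ht i y).eq_or_lt' with h | h
    · simp [h]
    · exact mul_nonneg (hpos W hW i y)
        (nonneg_of_mul_nonneg_right (hpos W' hW' i y) h)
  -- The coefficients have mean zero, so only the constant and the bilinear term survive in the
  -- expansion.
  have hHS : ∀ W W' i, HasSum
      (fun y => t i y * (1 + signForm (a i y) W) * (1 + signForm (a i y) W'))
      (1 + ∑' y, t i y * (signForm (a i y) W * signForm (a i y) W')) := by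
    intro W W' i
    have h := (((hsum i).add (hasSum_mul_signForm (hmean i) W)).add
      (hasSum_mul_signForm (hmean i) W')).add
      (summable_mul_signForm_mul (ht i) (hsum i).summable (hv i) W W').hasSum
    simp only [add_zero] at h
    convert h using 2
    ring
  have hsecond : ∑ W ∈ G, ∑ W' ∈ G, ∑' y : (∀ i, Y i), ENNReal.ofReal (∏ i,
      (t i (y i) * (1 + signForm (a i (y i)) W) * (1 + signForm (a i (y i)) W'))) ≤
      ENNReal.ofReal (5 / 4 * (G.card : ℝ) ^ 2) := by
    have hnn : ∀ W ∈ G, ∀ W' ∈ G, ∀ i,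
        0 ≤ 1 + ∑' y, t i y * (signForm (a i y) W * signForm (a i y) W') :=
      fun W hW W' hW' i => (hHS W W' i).nonneg (hpos2 W hW W' hW' i)
    calc _ = ∑ W ∈ G, ∑ W' ∈ G, ENNReal.ofReal
          (∏ i, (1 + ∑' y, t i y * (signForm (a i y) W * signForm (a i y) W'))) := by
          refine Finset.sum_congr rfl fun W hW => Finset.sum_congr rfl fun W' hW' => ?_
          simp_rw [ENNReal.ofReal_prod_of_nonneg fun i _ => hpos2 W hW W' hW' i _]
          rw [ENNReal.tsum_pi_prod fun i y => ENNReal.ofReal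
            (t i y * (1 + signForm (a i y) W) * (1 + signForm (a i y) W')),
            ENNReal.ofReal_prod_of_nonneg fun i _ => hnn W hW W' hW' i]
          refine Finset.prod_congr rfl fun i _ => ?_
          rw [← ENNReal.ofReal_tsum_of_nonneg (hpos2 W hW W' hW' i) (hHS W W' i).summable,
            (hHS W W' i).tsum_eq]
      _ = ENNReal.ofReal (∑ W ∈ G, ∑ W' ∈ G,
          ∏ i, (1 + ∑' y, t i y * (signForm (a i y) W * signForm (a i y) W'))) := by
          rw [ENNReal.ofReal_sum_of_nonneg fun W hW => Finset.sum_nonneg fun W' hW' =>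
            Finset.prod_nonneg fun i _ => hnn W hW W' hW' i]
          refine Finset.sum_congr rfl fun W hW => ?_
          rw [ENNReal.ofReal_sum_of_nonneg fun W' hW' =>
            Finset.prod_nonneg fun i _ => hnn W hW W' hW' i]
      _ ≤ _ := ENNReal.ofReal_le_ofReal
          (sum_sum_prod_one_add_le G hG hcard t ht hsum a hv hnv hnn)
  have hpt : ∀ y : (∀ i, Y i), ∑ W ∈ G, (if D y then
        ENNReal.ofReal (∏ i, (t i (y i) * (1 + signForm (a i (y i)) W))) else 0) ≤
      G.card * (if D y then ENNReal.ofReal (∏ i, t i (y i)) else 0) +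
      ENNReal.ofReal (1 / (4 * G.card)) * ∑ W ∈ G, ∑ W' ∈ G, ENNReal.ofReal (∏ i,
      (t i (y i) * (1 + signForm (a i (y i)) W) * (1 + signForm (a i (y i)) W'))) := by
    intro y
    split_ifs
    swap
    · simp
    rw [← ENNReal.ofReal_sum_of_nonneg fun W hW => Finset.prod_nonneg fun i _ => hpos W hW i _]
    have e1 : ∑ W ∈ G, ∑ W' ∈ G, ENNReal.ofReal (∏ i,
        (t i (y i) * (1 + signForm (a i (y i)) W) * (1 + signForm (a i (y i)) W'))) =
        ENNReal.ofReal (∑ W ∈ G, ∑ W' ∈ G, ∏ i,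
        (t i (y i) * (1 + signForm (a i (y i)) W) * (1 + signForm (a i (y i)) W'))) := by
      rw [ENNReal.ofReal_sum_of_nonneg fun W hW => Finset.sum_nonneg fun W' hW' =>
            Finset.prod_nonneg fun i _ => hpos2 W hW W' hW' i _]
      refine Finset.sum_congr rfl fun W hW => ?_
      rw [ENNReal.ofReal_sum_of_nonneg fun W' hW' =>
            Finset.prod_nonneg fun i _ => hpos2 W hW W' hW' i _]
    have hT : 0 ≤ ∏ i, t i (y i) := Finset.prod_nonneg fun i _ => ht i _
    rw [e1, ← ENNReal.ofReal_natCast, ← ENNReal.ofReal_mul (by positivity),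
      ← ENNReal.ofReal_mul (by positivity), ← ENNReal.ofReal_add (by positivity)
        (mul_nonneg (by positivity) (Finset.sum_nonneg fun W hW => Finset.sum_nonneg fun W' hW' =>
            Finset.prod_nonneg fun i _ => hpos2 W hW W' hW' i _))]
    refine ENNReal.ofReal_le_ofReal ?_
    simp_rw [Finset.prod_mul_distrib, mul_assoc, ← Finset.mul_sum, ← Finset.sum_mul]
    set S := ∑ W ∈ G, ∏ i, (1 + signForm (a i (y i)) W)
    set T := ∏ i, t i (y i)
    -- This inequality trades the averaged likelihood ratio for `1` plus a quarter of its square.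
    -- The second moment `5 / 4` then contributes `5 / 16`.
    have h1 : S ≤ G.card + 1 / (4 * G.card) * (S * S) := by
      have : (G.card + 1 / (4 * G.card) * (S * S) - S : ℝ) =
          (S - 2 * G.card) ^ 2 / (4 * G.card) := by
        field_simp
        ring
      have h2 : (0 : ℝ) ≤ (S - 2 * G.card) ^ 2 / (4 * G.card) := by positivity
      linarith
    calc T * S ≤ T * (G.card + 1 / (4 * G.card) * (S * S)) := mul_le_mul_of_nonneg_left h1 hT
      _ = _ := by ring
  rw [← Summable.tsum_finsetSum fun _ _ => ENNReal.summable]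
  refine (ENNReal.tsum_le_tsum hpt).trans ?_
  rw [ENNReal.tsum_add, ENNReal.tsum_mul_left, ENNReal.tsum_mul_left, mul_add]
  refine add_le_add le_rfl ?_
  rw [Summable.tsum_finsetSum fun _ _ => ENNReal.summable]
  simp_rw [Summable.tsum_finsetSum (fun _ _ => ENNReal.summable)]
  refine (mul_le_mul_right hsecond _).trans ?_
  rw [← ENNReal.ofReal_natCast, ← ENNReal.ofReal_mul (by positivity),
    ← ENNReal.ofReal_mul (by positivity)]
  refine ENNReal.ofReal_le_ofReal (le_of_eq ?_)
  field_simp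
  norm_num

end Mixture

/-! ### Hölder's inequality for the trace norm, and the distance of pure states. -/

section TraceNorm

open Matrix

variable {ι : Type*} [Fintype ι] [DecidableEq ι]

lemma Matrix.IsHermitian.trace_mul_self_eq_sum {B : Matrix ι ι ℂ} (hB : B.IsHermitian) :
    (B * B).trace = ∑ i, (hB.eigenvalues i : ℂ) ^ 2 := by
  have h := hB.spectral_theorem
  set φ := Unitary.conjStarAlgAut ℂ (Matrix ι ι ℂ) hB.eigenvectorUnitary
  set D : Matrix ι ι ℂ := diagonal (RCLike.ofReal ∘ hB.eigenvalues) with hD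
  have h2 : B * B = φ (D * D) := by rw [map_mul, ← h]
  have h3 : (φ (D * D)).trace = (D * D).trace := by
    simp only [φ, Unitary.conjStarAlgAut_apply]
    rw [trace_mul_cycle, Unitary.coe_star_mul_self, one_mul]
  rw [h2, h3, hD, diagonal_mul_diagonal, trace_diagonal]
  simp [pow_two]

/-- Hölder's inequality `Tr A* A ≤ s Tr |A|` for a matrix with `A* A ≤ s²`. -/
lemma trace_conjTranspose_mul_self_le {A : Matrix ι ι ℂ} {s : ℝ} (hs : 0 ≤ s)
    (h : (((s ^ 2 : ℝ) : ℂ) • (1 : Matrix ι ι ℂ) - Aᴴ * A).PosSemidef) :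
    (Aᴴ * A).trace.re ≤ s * (2 * qTraceNorm A) := by
  have hB : (CFC.abs A).PosSemidef := nonneg_iff_posSemidef.1 (CFC.abs_nonneg A)
  have hBB : CFC.abs A * CFC.abs A = Aᴴ * A := CFC.abs_mul_abs A
  have hle : ∀ i, hB.isHermitian.eigenvalues i ≤ s := by
    intro i
    set x : ι → ℂ := ⇑(hB.isHermitian.eigenvectorBasis i) with hx
    have hev := hB.isHermitian.mulVec_eigenvectorBasis i
    rw [← hx] at hev
    have hx1 : star x ⬝ᵥ x = 1 := by
      have := hB.isHermitian.eigenvectorBasis.orthonormal.1 i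
      have h2 := inner_self_eq_norm_sq_to_K (𝕜 := ℂ) (hB.isHermitian.eigenvectorBasis i)
      rw [this, EuclideanSpace.inner_eq_star_dotProduct, dotProduct_comm] at h2
      simpa using h2
    have h1 := h.dotProduct_mulVec_nonneg x
    rw [← hBB, sub_mulVec, ← mulVec_mulVec, hev, mulVec_smul, hev, smul_mulVec, one_mulVec,
      dotProduct_sub, dotProduct_smul, dotProduct_smul, dotProduct_smul, hx1] at h1
    have h3 : (0 : ℝ) ≤ s ^ 2 - hB.isHermitian.eigenvalues i * hB.isHermitian.eigenvalues i := by
      have := (Complex.le_def.1 h1).1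
      simpa [← Complex.ofReal_pow] using this
    nlinarith [hB.eigenvalues_nonneg i]
  rw [← hBB, hB.isHermitian.trace_mul_self_eq_sum, qTraceNorm,
    hB.isHermitian.trace_eq_sum_eigenvalues]
  have e1 : (∑ i, (hB.isHermitian.eigenvalues i : ℂ) ^ 2).re =
      ∑ i, hB.isHermitian.eigenvalues i ^ 2 := by
    rw [Complex.re_sum]
    exact Finset.sum_congr rfl fun i _ => by rw [← Complex.ofReal_pow, Complex.ofReal_re]
  have e2 : (∑ i, ((hB.isHermitian.eigenvalues i : ℝ) : ℂ)).re =
      ∑ i, hB.isHermitian.eigenvalues i := by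
    rw [Complex.re_sum]
    simp
  rw [e1]
  erw [e2]
  calc ∑ i, hB.isHermitian.eigenvalues i ^ 2 ≤ ∑ i, s * hB.isHermitian.eigenvalues i := by
        refine Finset.sum_le_sum fun i _ => ?_
        nlinarith [hB.eigenvalues_nonneg i, hle i]
    _ = _ := by rw [← Finset.mul_sum]; ring

/-- With `B = s - A` and `C = s + A`, the sum `B C B + C B C` equals `2 s (s² - A²)`, and both
summands are positive semidefinite. -/
lemma posSemidef_sq_sub_of_pm {A : Matrix ι ι ℂ} {s : ℝ} (hs : 0 < s)
    (h1 : ((s : ℂ) • (1 : Matrix ι ι ℂ) - A).PosSemidef)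
    (h2 : ((s : ℂ) • (1 : Matrix ι ι ℂ) + A).PosSemidef) :
    (((s ^ 2 : ℝ) : ℂ) • (1 : Matrix ι ι ℂ) - A * A).PosSemidef := by
  have e1 := h2.conjTranspose_mul_mul_same ((s : ℂ) • (1 : Matrix ι ι ℂ) - A)
  have e2 := h1.conjTranspose_mul_mul_same ((s : ℂ) • (1 : Matrix ι ι ℂ) + A)
  rw [h1.isHermitian.eq] at e1
  rw [h2.isHermitian.eq] at e2
  have h3 : (0 : ℂ) ≤ (((2 * s)⁻¹ : ℝ) : ℂ) := by
    exact_mod_cast (by positivity : (0 : ℝ) ≤ (2 * s)⁻¹)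
  have h4 := (e1.add e2).smul h3
  convert h4 using 1
  have h5 : ((s : ℂ) • (1 : Matrix ι ι ℂ) - A) * ((s : ℂ) • (1 : Matrix ι ι ℂ) + A) *
      ((s : ℂ) • (1 : Matrix ι ι ℂ) - A) +
      ((s : ℂ) • (1 : Matrix ι ι ℂ) + A) * ((s : ℂ) • (1 : Matrix ι ι ℂ) - A) *
      ((s : ℂ) • (1 : Matrix ι ι ℂ) + A) =
      ((2 * s : ℝ) : ℂ) • (((s ^ 2 : ℝ) : ℂ) • (1 : Matrix ι ι ℂ) - A * A) := by
    simp only [mul_add, add_mul, mul_sub, sub_mul, smul_mul_assoc, mul_smul_comm, one_mul, mul_one,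
      smul_sub, smul_add, smul_smul, mul_assoc]
    push_cast
    module
  rw [h5, smul_smul]
  have : (((2 * s)⁻¹ : ℝ) : ℂ) * ((2 * s : ℝ) : ℂ) = 1 := by
    rw [← Complex.ofReal_mul, inv_mul_cancel₀ (by positivity), Complex.ofReal_one]
  rw [this, one_smul]

/-- The trace distance of two pure states bounds their infidelity. -/
lemma one_sub_normSq_le_of_qTraceNorm_le {v w : ι → ℂ} (hv : star v ⬝ᵥ v = 1)
    (hw : star w ⬝ᵥ w = 1) {α : ℝ} (hα : 0 ≤ α)
    (h : qTraceNorm (vecMulVec v (star v) - vecMulVec w (star w)) ≤ α) :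
    1 - ‖star v ⬝ᵥ w‖ ^ 2 ≤ α ^ 2 := by
  set p := vecMulVec v (star v) with hp
  set q := vecMulVec w (star w) with hq
  set c := star v ⬝ᵥ w with hc
  have hc' : star w ⬝ᵥ v = star c := by
    rw [hc, star_dotProduct]
  have hcc : c * star c = ((‖c‖ ^ 2 : ℝ) : ℂ) := by
    rw [Complex.star_def, Complex.mul_conj, Complex.normSq_eq_norm_sq]
  have hcc' : star c * c = ((‖c‖ ^ 2 : ℝ) : ℂ) := by rw [mul_comm, hcc]
  have hpp : p * p = p := by
    rw [hp, vecMulVec_mul_vecMulVec, hv, one_smul]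
  have hqq : q * q = q := by
    rw [hq, vecMulVec_mul_vecMulVec, hw, one_smul]
  have hpqp : p * q * p = ((‖c‖ ^ 2 : ℝ) : ℂ) • p := by
    rw [hp, hq, vecMulVec_mul_vecMulVec, ← hc, vecMulVec_smul, smul_mul_assoc,
      vecMulVec_mul_vecMulVec, hc', vecMulVec_smul, smul_smul, hcc]
  have hqpq : q * p * q = ((‖c‖ ^ 2 : ℝ) : ℂ) • q := by
    rw [hp, hq, vecMulVec_mul_vecMulVec, hc', vecMulVec_smul, smul_mul_assoc,
      vecMulVec_mul_vecMulVec, ← hc, vecMulVec_smul, smul_smul, hcc']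
  have hpH : pᴴ = p := (posSemidef_vecMulVec_self_star v).isHermitian.eq
  have hqH : qᴴ = q := (posSemidef_vecMulVec_self_star w).isHermitian.eq
  have hAH : (p - q)ᴴ = p - q := by rw [conjTranspose_sub, hpH, hqH]
  by_cases hs : 1 - ‖c‖ ^ 2 ≤ 0
  · exact hs.trans (sq_nonneg _)
  push Not at hs
  set s := √(1 - ‖c‖ ^ 2) with hsdef
  have hs0 : 0 < s := Real.sqrt_pos.2 hs
  have hs2 : s ^ 2 = 1 - ‖c‖ ^ 2 := Real.sq_sqrt hs.le
  -- The nonzero eigenvalues of `p - q` are `±s`. The cubic identity encodes this and makes `s² -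
  -- A²` a multiple of a projection, hence positive semidefinite.
  have hA3 : (p - q) * (p - q) * (p - q) = ((s ^ 2 : ℝ) : ℂ) • (p - q) := by
    calc (p - q) * (p - q) * (p - q) = p * p * p - p * p * q - p * q * p + p * (q * q)
          - q * (p * p) + q * p * q + q * q * p - q * q * q := by noncomm_ring
      _ = _ := by
        rw [hpp, hqq, hpp, hqq, hpqp, hqpq, hs2]
        push_cast
        module
  set A := p - q with hA
  have htr : (Aᴴ * A).trace.re = 2 * s ^ 2 := by
    have : A * A = p - p * q - q * p + q := by
      calc A * A = p * p - p * q - q * p + q * q := by rw [hA]; noncomm_ring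
        _ = _ := by rw [hpp, hqq]
    rw [hAH, this, hp, hq, vecMulVec_mul_vecMulVec, vecMulVec_mul_vecMulVec, ← hc, hc']
    simp only [vecMulVec_smul, trace_add, trace_sub, trace_smul, trace_vecMulVec]
    rw [dotProduct_comm v, hv, dotProduct_comm w (star w), hw, dotProduct_comm v, hc',
      dotProduct_comm w, ← hc, smul_eq_mul, smul_eq_mul, hcc, hcc', hs2]
    simp only [Complex.add_re, Complex.sub_re, Complex.one_re, Complex.ofReal_re]
    ring
  have hpsd : (((s ^ 2 : ℝ) : ℂ) • (1 : Matrix ι ι ℂ) - Aᴴ * A).PosSemidef := by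
    set P := ((s ^ 2 : ℝ) : ℂ) • (1 : Matrix ι ι ℂ) - Aᴴ * A with hP
    have h1 : Pᴴ = P := by
      rw [hP, conjTranspose_sub, conjTranspose_smul, conjTranspose_one, conjTranspose_mul,
        conjTranspose_conjTranspose]
      simp
    have h2 := posSemidef_conjTranspose_mul_self P
    have h3 : (0 : ℂ) ≤ (((s ^ 2)⁻¹ : ℝ) : ℂ) := by
      exact_mod_cast (by positivity : (0 : ℝ) ≤ (s ^ 2)⁻¹)
    convert h2.smul h3 using 1
    have h4 : P * P = ((s ^ 2 : ℝ) : ℂ) • P := by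
      have h5 : A * A * (A * A) = ((s ^ 2 : ℝ) : ℂ) • (A * A) := by
        rw [← mul_assoc, hA3, smul_mul_assoc]
      rw [hP, hAH]
      simp only [mul_sub, sub_mul, smul_mul_assoc, mul_smul_comm, one_mul, mul_one, h5]
      module
    rw [h1, h4, smul_smul, ← Complex.ofReal_mul, inv_mul_cancel₀ (by positivity),
      Complex.ofReal_one, one_smul]
  -- Since `Tr A² = 2 s²`, Hölder's inequality gives `s ≤ qTraceNorm A`.
  have h6 := trace_conjTranspose_mul_self_le hs0.le hpsd
  rw [htr] at h6
  have h7 : s ≤ α := by nlinarith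
  rw [← hs2]
  exact pow_le_pow_left₀ hs0.le h7 2

end TraceNorm

/-! ### From gentleness to operators that nearly fix directions. -/

section Gentle

open Matrix

variable {ι : Type*} [Fintype ι] [DecidableEq ι]

/-- A gentle measurement operator leaves every vector nearly invariant up to scaling. -/
lemma IsGentle.le_normSq {Y : Type*} {α : ℝ} {M : Y → Matrix ι ι ℂ} (hM : IsGentle α M)
    (hα : 0 ≤ α) (y : Y) (v : EuclideanSpace ℂ ι) (hv : ‖v‖ = 1) :
    (1 - α ^ 2) * ‖toEuclideanLin (M y) v‖ ^ 2 ≤ ‖inner ℂ v (toEuclideanLin (M y) v)‖ ^ 2 := by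
  set u : ι → ℂ := v.ofLp with hu
  set x : ι → ℂ := M y *ᵥ u with hx
  have hTv : toEuclideanLin (M y) v = WithLp.toLp 2 x := by
    rw [toLpLin_apply]
  set N := ‖toEuclideanLin (M y) v‖ with hN
  have hxx : star x ⬝ᵥ x = ((N ^ 2 : ℝ) : ℂ) := by
    have := inner_self_eq_norm_sq_to_K (𝕜 := ℂ) (toEuclideanLin (M y) v)
    rw [← hN, hTv, EuclideanSpace.inner_eq_star_dotProduct, dotProduct_comm] at this
    simpa using this
  have huu : star u ⬝ᵥ u = 1 := by
    have := inner_self_eq_norm_sq_to_K (𝕜 := ℂ) v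
    rw [hv, EuclideanSpace.inner_eq_star_dotProduct, dotProduct_comm] at this
    simpa using this
  rcases eq_or_ne N 0 with h0 | h0
  · rw [h0]; simp
  have hNpos : 0 < N := lt_of_le_of_ne (norm_nonneg _) (Ne.symm h0)
  have hstate : IsState (vecMulVec u (star u)) :=
    ⟨posSemidef_vecMulVec_self_star u, by rw [trace_vecMulVec, dotProduct_comm, huu]⟩
  have hxs : star x = star u ᵥ* (M y)ᴴ := by rw [hx, star_mulVec]
  have hprob : outcomeProb M (vecMulVec u (star u)) y = N ^ 2 := by
    rw [outcomeProb, trace_mul_comm, mul_vecMulVec, trace_vecMulVec, ← mulVec_mulVec, ← hx,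
      dotProduct_comm, dotProduct_mulVec, ← hxs, hxx, Complex.ofReal_re]
  -- A pure state stays pure, so gentleness becomes a bound on the infidelity of `v` and its
  -- normalised image.
  have hpost : postState M (vecMulVec u (star u)) y =
      vecMulVec ((N⁻¹ : ℂ) • x) (star ((N⁻¹ : ℂ) • x)) := by
    rw [postState, hprob, mul_vecMulVec, vecMulVec_mul, ← hxs, ← hx, star_smul, smul_vecMulVec,
      vecMulVec_smul, smul_smul]
    ext i j
    simp [pow_two, mul_assoc]
  have h1 := hM _ hstate y (by rw [hprob]; positivity)
  rw [hpost] at h1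
  have hww : star ((N⁻¹ : ℂ) • x) ⬝ᵥ ((N⁻¹ : ℂ) • x) = 1 := by
    rw [star_smul, smul_dotProduct, dotProduct_smul, hxx]
    have : (N : ℂ) ≠ 0 := by exact_mod_cast h0
    simp
    field_simp
  have h2 := one_sub_normSq_le_of_qTraceNorm_le huu hww hα h1
  have h3 : inner ℂ v (toEuclideanLin (M y) v) = star u ⬝ᵥ x := by
    rw [hTv, EuclideanSpace.inner_eq_star_dotProduct, dotProduct_comm]
  rw [h3]
  rw [dotProduct_smul, norm_smul, mul_pow] at h2
  have h4 : ‖((N : ℂ)⁻¹)‖ ^ 2 = (N ^ 2)⁻¹ := by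
    rw [norm_inv, Complex.norm_real, Real.norm_eq_abs, inv_pow, sq_abs]
  rw [h4] at h2
  have h5 := mul_le_mul_of_nonneg_right h2 (sq_nonneg N)
  rw [sub_mul, mul_comm (N ^ 2)⁻¹, mul_assoc, inv_mul_cancel₀ (by positivity)] at h5
  linarith

end Gentle

/-! ### Nearly invariant operators nearly preserve orthogonality. -/

section NearlyInvariant

variable {E : Type*} [NormedAddCommGroup E] [InnerProductSpace ℂ E]

/-- Both bounds are used: the first is small with `α`, but at `α = 1 / 2` it is no better than
Cauchy–Schwarz. The second keeps the constant below `1`, through `(A x + P y)² = N K - (A y - P x)²`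
and `3 P x ≤ A y`. -/
lemma sq_add_le_of_sq_le {A P x y N K α : ℝ} (hA : 0 ≤ A) (hy : 0 ≤ y)
    (hα : α ^ 2 ≤ 1 / 4) (h1 : A ^ 2 + P ^ 2 = N) (h2 : x ^ 2 + y ^ 2 = K)
    (hPN : P ^ 2 ≤ α ^ 2 * N) (hxK : x ^ 2 ≤ α ^ 2 * K) :
    (A * x + P * y) ^ 2 ≤ 4 * α ^ 2 * (N * K) ∧ (A * x + P * y) ^ 2 ≤ 3 / 4 * (N * K) := by
  have hN : 0 ≤ N := by rw [← h1]; positivity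
  have hK : 0 ≤ K := by rw [← h2]; positivity
  constructor
  · have e1 : A ^ 2 * x ^ 2 ≤ N * (α ^ 2 * K) :=
      mul_le_mul (by nlinarith) hxK (sq_nonneg _) hN
    have e2 : P ^ 2 * y ^ 2 ≤ (α ^ 2 * N) * K :=
      mul_le_mul hPN (by nlinarith) (sq_nonneg _) (by positivity)
    nlinarith [sq_nonneg (A * x - P * y)]
  · have hP' : P ^ 2 ≤ N / 4 := by nlinarith
    have hx' : x ^ 2 ≤ K / 4 := by nlinarith
    have hA' : 3 / 4 * N ≤ A ^ 2 := by linarith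
    have hy' : 3 / 4 * K ≤ y ^ 2 := by linarith
    have e1 : (3 / 4 * N) * (3 / 4 * K) ≤ A ^ 2 * y ^ 2 :=
      mul_le_mul hA' hy' (by positivity) (sq_nonneg _)
    have e2 : P ^ 2 * x ^ 2 ≤ (N / 4) * (K / 4) :=
      mul_le_mul hP' hx' (sq_nonneg _) (by positivity)
    have e3 : 3 * (P * x) ≤ A * y := by
      refine abs_le_of_sq_le_sq' ?_ (by positivity) |>.2
      nlinarith
    have e4 : (2 / 3 * (A * y)) ^ 2 ≤ (A * y - P * x) ^ 2 := by
      refine pow_le_pow_left₀ (by positivity) ?_ 2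
      linarith
    have e5 : (A * x + P * y) ^ 2 = N * K - (A * y - P * x) ^ 2 := by
      rw [← h1, ← h2]; ring
    rw [e5]
    nlinarith

lemma norm_sq_eq_add_of_unit {u : E} (hu : ‖u‖ = 1) (w : E) :
    ‖inner ℂ u w‖ ^ 2 + ‖w - inner ℂ u w • u‖ ^ 2 = ‖w‖ ^ 2 := by
  have horth : inner ℂ (inner ℂ u w • u) (w - inner ℂ u w • u) = 0 := by
    rw [inner_smul_left, inner_sub_right, inner_smul_right, inner_self_eq_norm_sq_to_K, hu]
    simp
  have h := norm_add_sq_eq_norm_sq_add_norm_sq_of_inner_eq_zero _ _ horth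
  rw [add_sub_cancel, norm_smul, hu, mul_one] at h
  nlinarith

/-- Vectors that are nearly parallel to two orthogonal directions are nearly orthogonal. -/
lemma normSq_inner_le_of_nearly_parallel {u v w₁ w₂ : E} (hu : ‖u‖ = 1) (hv : ‖v‖ = 1)
    (huv : inner ℂ u v = 0) {α : ℝ} (hα : α ^ 2 ≤ 1 / 4)
    (h1 : (1 - α ^ 2) * ‖w₁‖ ^ 2 ≤ ‖inner ℂ u w₁‖ ^ 2)
    (h2 : (1 - α ^ 2) * ‖w₂‖ ^ 2 ≤ ‖inner ℂ v w₂‖ ^ 2) :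
    ‖inner ℂ w₁ w₂‖ ^ 2 ≤ 4 * α ^ 2 * (‖w₁‖ ^ 2 * ‖w₂‖ ^ 2) ∧
      ‖inner ℂ w₁ w₂‖ ^ 2 ≤ 3 / 4 * (‖w₁‖ ^ 2 * ‖w₂‖ ^ 2) := by
  have hN := norm_sq_eq_add_of_unit hu w₁
  have hK := norm_sq_eq_add_of_unit hu w₂
  set a := inner ℂ u w₁ with ha
  set x := inner ℂ u w₂ with hx
  set p := w₁ - a • u with hp
  set r := w₂ - x • u with hr
  have hb : ‖inner ℂ v w₂‖ ≤ ‖r‖ := by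
    have : inner ℂ v r = inner ℂ v w₂ := by
      rw [hr, inner_sub_right, inner_smul_right, inner_eq_zero_symm.1 huv]
      simp
    rw [← this]
    simpa [hv] using norm_inner_le_norm (𝕜 := ℂ) v r
  have hb2 : ‖inner ℂ v w₂‖ ^ 2 ≤ ‖r‖ ^ 2 := pow_le_pow_left₀ (norm_nonneg _) hb 2
  obtain ⟨e1, e2⟩ := sq_add_le_of_sq_le (norm_nonneg a) (norm_nonneg r) hα hN hK (by linarith) (by linarith)
  have hle : ‖inner ℂ w₁ w₂‖ ≤ ‖a‖ * ‖x‖ + ‖p‖ * ‖r‖ := by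
    have : inner ℂ w₁ w₂ = starRingEnd ℂ a * x + inner ℂ p r := by
      rw [hp, hr, inner_sub_left, inner_sub_right, inner_sub_right, inner_smul_left,
        inner_smul_left, inner_smul_right, inner_smul_right, ← hx,
        inner_self_eq_norm_sq_to_K, hu, ← inner_conj_symm w₁ u, ← ha]
      simp
      ring
    rw [this]
    refine (norm_add_le _ _).trans (add_le_add ?_ (norm_inner_le_norm _ _))
    rw [norm_mul, RCLike.norm_conj]
  have hle2 := pow_le_pow_left₀ (norm_nonneg _) hle 2
  exact ⟨hle2.trans e1, hle2.trans e2⟩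

/-- Every vector is mapped into a small angle around itself. -/
def NearlyInvariant (α : ℝ) (T : E →ₗ[ℂ] E) : Prop :=
  ∀ v : E, ‖v‖ = 1 → (1 - α ^ 2) * ‖T v‖ ^ 2 ≤ ‖inner ℂ v (T v)‖ ^ 2

variable {α : ℝ} {T : E →ₗ[ℂ] E}

/-- The unit vectors along `u + v` and `u - v` are orthogonal, so their images make an angle bounded
away from zero. The real part of the inner product of `T u + T v` and `T u - T v` is the difference
of the squared norms, which is therefore at most `√3 / 2` of their sum. The ratio is at most `7 + 4
√3 < 14`. -/
lemma NearlyInvariant.normSq_le (hT : NearlyInvariant α T) (hα : α ^ 2 ≤ 1 / 4) {u v : E}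
    (hu : ‖u‖ = 1) (hv : ‖v‖ = 1) (huv : inner ℂ u v = 0) :
    ‖T u‖ ^ 2 ≤ 14 * ‖T v‖ ^ 2 := by
  have hvu : inner ℂ v u = 0 := inner_eq_zero_symm.1 huv
  have horth : inner ℂ (u + v) (u - v) = 0 := by
    rw [inner_add_left, inner_sub_right, inner_sub_right, huv, hvu,
      inner_self_eq_norm_sq_to_K, inner_self_eq_norm_sq_to_K, hu, hv]
    simp
  have hnp : ‖u + v‖ ^ 2 = 2 := by
    have := norm_add_sq_eq_norm_sq_add_norm_sq_of_inner_eq_zero _ _ huv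
    rw [hu, hv] at this
    nlinarith
  have hnm : ‖u - v‖ ^ 2 = 2 := by
    have := parallelogram_law_with_norm ℂ u v
    rw [hu, hv] at this
    nlinarith
  have hs : (0 : ℝ) < √2 := by positivity
  have hunit : ∀ w : E, ‖w‖ ^ 2 = 2 → ‖(((√2)⁻¹ : ℝ) : ℂ) • w‖ = 1 := by
    intro w hw
    have : ‖w‖ = √2 := by rw [← hw, Real.sqrt_sq (norm_nonneg _)]
    rw [norm_smul, this, Complex.norm_real, Real.norm_eq_abs, abs_of_pos (inv_pos.2 hs),
      inv_mul_cancel₀ hs.ne']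
  have h := (normSq_inner_le_of_nearly_parallel (hunit _ hnp) (hunit _ hnm)
    (by rw [inner_smul_left, inner_smul_right, horth]; simp) hα
    (hT _ (hunit _ hnp)) (hT _ (hunit _ hnm))).2
  have hc : ‖(((√2)⁻¹ : ℝ) : ℂ)‖ ^ 2 = 1 / 2 := by
    rw [Complex.norm_real, Real.norm_eq_abs, sq_abs, inv_pow, Real.sq_sqrt (by norm_num)]
    norm_num
  rw [map_smul, map_smul, inner_smul_left, inner_smul_right, norm_mul, norm_mul, RCLike.norm_conj,
    norm_smul, norm_smul, mul_pow, mul_pow, mul_pow, mul_pow, hc, map_add, map_sub] at h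
  have hre : (inner ℂ (T u + T v) (T u - T v)).re = ‖T u‖ ^ 2 - ‖T v‖ ^ 2 := by
    rw [inner_add_left, inner_sub_right, inner_sub_right, inner_self_eq_norm_sq_to_K,
      inner_self_eq_norm_sq_to_K]
    have := inner_re_symm (𝕜 := ℂ) (T u) (T v)
    simp only [RCLike.re_to_complex] at this
    simp [← Complex.ofReal_pow, this]
  have habs : (‖T u‖ ^ 2 - ‖T v‖ ^ 2) ^ 2 ≤ ‖inner ℂ (T u + T v) (T u - T v)‖ ^ 2 := by
    rw [← hre, ← sq_abs]
    exact pow_le_pow_left₀ (abs_nonneg _) (Complex.abs_re_le_norm _) 2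
  have hpar := parallelogram_law_with_norm ℂ (T u) (T v)
  set P := ‖T u + T v‖
  set Q := ‖T u - T v‖
  set a := ‖T u‖
  set b := ‖T v‖
  have h3 : (a ^ 2 - b ^ 2) ^ 2 ≤ 3 / 4 * (a ^ 2 + b ^ 2) ^ 2 := by
    nlinarith [sq_nonneg (P ^ 2 - Q ^ 2)]
  by_contra hcon
  push Not at hcon
  nlinarith [sq_nonneg a, sq_nonneg b]

lemma NearlyInvariant.normSq_inner_le (hT : NearlyInvariant α T) (hα : α ^ 2 ≤ 1 / 4) {x v : E}
    (hv : ‖v‖ = 1) (hxv : inner ℂ x v = 0) :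
    ‖inner ℂ (T x) (T v)‖ ^ 2 ≤ 56 * α ^ 2 * ‖x‖ ^ 2 * (‖T v‖ ^ 2) ^ 2 := by
  rcases eq_or_ne x 0 with rfl | hx
  · simp
  have hx0 : 0 < ‖x‖ := norm_pos_iff.2 hx
  set u : E := (((‖x‖)⁻¹ : ℝ) : ℂ) • x with hu
  have hu1 : ‖u‖ = 1 := by
    rw [hu, norm_smul, Complex.norm_real, Real.norm_eq_abs, abs_of_pos (inv_pos.2 hx0),
      inv_mul_cancel₀ hx0.ne']
  have huv : inner ℂ u v = 0 := by rw [hu, inner_smul_left, hxv, mul_zero]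
  have hxu : x = ((‖x‖ : ℝ) : ℂ) • u := by
    rw [hu, smul_smul, ← Complex.ofReal_mul, mul_inv_cancel₀ hx0.ne', Complex.ofReal_one, one_smul]
  have h1 := (normSq_inner_le_of_nearly_parallel hu1 hv huv hα (hT u hu1) (hT v hv)).1
  have h2 := hT.normSq_le hα hu1 hv huv
  have h3 : ‖inner ℂ (T x) (T v)‖ ^ 2 = ‖x‖ ^ 2 * ‖inner ℂ (T u) (T v)‖ ^ 2 := by
    conv_lhs => rw [hxu]
    rw [map_smul, inner_smul_left, norm_mul, RCLike.norm_conj, Complex.norm_real, norm_norm,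
      mul_pow]
  rw [h3]
  calc ‖x‖ ^ 2 * ‖inner ℂ (T u) (T v)‖ ^ 2 ≤
        ‖x‖ ^ 2 * (4 * α ^ 2 * ((14 * ‖T v‖ ^ 2) * ‖T v‖ ^ 2)) := by
        refine mul_le_mul_of_nonneg_left (h1.trans ?_) (sq_nonneg _)
        gcongr
    _ = _ := by ring

/-- The components of `T* T v` along orthonormal vectors orthogonal to `v` are small. -/
lemma NearlyInvariant.sum_normSq_inner_le (hT : NearlyInvariant α T) (hα : α ^ 2 ≤ 1 / 4)
    {κ : Type*} [Fintype κ] {f : κ → E} (hf : Orthonormal ℂ f) {v : E} (hv : ‖v‖ = 1)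
    (hfv : ∀ j, inner ℂ (f j) v = 0) :
    ∑ j, ‖inner ℂ (T (f j)) (T v)‖ ^ 2 ≤ 56 * α ^ 2 * (‖T v‖ ^ 2) ^ 2 := by
  set c : κ → ℂ := fun j => inner ℂ (T (f j)) (T v) with hc
  -- Testing on the combination whose coefficients are the components themselves bounds all of them
  -- at once, without a factor for their number: both `‖x‖²` and the inner product of `T x` and `T
  -- v` equal `N`.
  set x : E := ∑ j, c j • f j with hx
  set N : ℝ := ∑ j, ‖c j‖ ^ 2 with hN
  have hN0 : 0 ≤ N := Finset.sum_nonneg fun _ _ => sq_nonneg _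
  have hsum : ∀ z : κ → ℂ, (∀ j, z j = starRingEnd ℂ (c j) * c j) →
      ∑ j, z j = ((N : ℝ) : ℂ) := by
    intro z hz
    rw [hN]
    push_cast
    refine Finset.sum_congr rfl fun j _ => ?_
    rw [hz, mul_comm, Complex.mul_conj, Complex.normSq_eq_norm_sq]
    push_cast
    rfl
  have hxx : ‖x‖ ^ 2 = N := by
    have h1 := inner_self_eq_norm_sq_to_K (𝕜 := ℂ) x
    rw [hx, hf.inner_sum, ← hx, hsum _ fun j => rfl] at h1
    have h2 : ((N : ℝ) : ℂ) = ((‖x‖ ^ 2 : ℝ) : ℂ) := by rw [h1]; push_cast; rfl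
    exact (Complex.ofReal_injective h2).symm
  have hxv : inner ℂ x v = 0 := by
    rw [hx, sum_inner]
    exact Finset.sum_eq_zero fun j _ => by rw [inner_smul_left, hfv, mul_zero]
  have hT' : inner ℂ (T x) (T v) = ((N : ℝ) : ℂ) := by
    rw [hx, map_sum, sum_inner, hsum]
    intro j
    rw [map_smul, inner_smul_left]
  have h := hT.normSq_inner_le hα hv hxv
  rw [hT', hxx, Complex.norm_real, Real.norm_eq_abs, sq_abs] at h
  change N ≤ _
  rcases hN0.eq_or_lt' with h0 | h0
  · rw [h0]; positivity
  · refine le_of_mul_le_mul_left ?_ h0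
    linarith

end NearlyInvariant

/-! ### Hilbert–Schmidt bounds on the effects of a gentle measurement. -/

section GentleEntries

open Matrix

lemma inner_toEuclideanLin_single {d : ℕ} (A : Matrix (Fin d) (Fin d) ℂ) (j k : Fin d) :
    inner ℂ (toEuclideanLin A (EuclideanSpace.single j 1))
      (toEuclideanLin A (EuclideanSpace.single k 1)) = (Aᴴ * A) j k := by
  rw [EuclideanSpace.inner_eq_star_dotProduct, toLpLin_apply, toLpLin_apply]
  simp [mul_apply, dotProduct, mul_comm]

/-- The off-diagonal blocks of the effects of a gentle measurement are small in Hilbert–Schmidt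
norm. -/
lemma IsGentle.sum_normSq_block_le {d m : ℕ} {Y : Type*} {α : ℝ}
    {M : Y → Matrix (Fin d) (Fin d) ℂ} (hM : IsGentle α M) (hα0 : 0 ≤ α) (hα : α ≤ 1 / 2) (y : Y)
    {f g : Fin m → Fin d} (hf : Function.Injective f) (hfg : ∀ j k, f j ≠ g k) :
    ∑ k, ∑ j, ‖((M y)ᴴ * M y) (f j) (g k)‖ ^ 2 ≤
      10976 * α ^ 2 * m * (((M y)ᴴ * M y).trace.re / d) ^ 2 := by
  set T := toEuclideanLin (M y) with hTdef
  set e : Fin d → EuclideanSpace ℂ (Fin d) := fun j => EuclideanSpace.single j 1 with he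
  have hα2 : α ^ 2 ≤ 1 / 4 := by nlinarith
  have hT : NearlyInvariant α T := fun v hv => hM.le_normSq hα0 y v hv
  have horth : Orthonormal ℂ e := EuclideanSpace.orthonormal_single
  have hdiag : ∀ k, (((M y)ᴴ * M y) k k).re = ‖T (e k)‖ ^ 2 := by
    intro k
    rw [← inner_toEuclideanLin_single, ← hTdef, inner_self_eq_norm_sq_to_K]
    simp [← Complex.ofReal_pow, he]
  have htr : ((M y)ᴴ * M y).trace.re = ∑ k, ‖T (e k)‖ ^ 2 := by
    rw [trace, Complex.re_sum]
    exact Finset.sum_congr rfl fun k _ => hdiag k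
  -- Averaging the comparison of column norms over all columns bounds each one by the mean.
  have hcol : ∀ k, ‖T (e k)‖ ^ 2 ≤ 14 * (((M y)ᴴ * M y).trace.re / d) := by
    intro k
    have hd : (0 : ℝ) < d := by exact_mod_cast (Nat.zero_le _).trans_lt k.isLt
    rw [htr, mul_div_assoc', le_div_iff₀ hd, Finset.mul_sum]
    calc ‖T (e k)‖ ^ 2 * d = ∑ _l : Fin d, ‖T (e k)‖ ^ 2 := by simp [mul_comm]
      _ ≤ _ := by
        refine Finset.sum_le_sum fun l _ => ?_
        rcases eq_or_ne k l with rfl | hkl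
        · nlinarith [sq_nonneg ‖T (e k)‖]
        · exact hT.normSq_le hα2 (horth.1 k) (horth.1 l) (horth.2 hkl)
  calc ∑ k, ∑ j, ‖((M y)ᴴ * M y) (f j) (g k)‖ ^ 2
      ≤ ∑ _k : Fin m, 56 * α ^ 2 * (14 * (((M y)ᴴ * M y).trace.re / d)) ^ 2 := by
        refine Finset.sum_le_sum fun k _ => ?_
        simp_rw [← inner_toEuclideanLin_single]
        refine (hT.sum_normSq_inner_le hα2 (horth.comp f hf) (horth.1 (g k))
          fun j => horth.2 (hfg j k)).trans ?_
        gcongr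
        exact hcol _
    _ = _ := by
        simp
        ring

end GentleEntries

/-! ### Product measurements and their outcome probabilities. -/

section Tensor

open Matrix

variable {n d : ℕ}

lemma tensorMatrix_mul (A B : Fin n → Matrix (Fin d) (Fin d) ℂ) :
    tensorMatrix A * tensorMatrix B = tensorMatrix fun i => A i * B i := by
  ext a b
  simp only [tensorMatrix, mul_apply, of_apply, ← Finset.prod_mul_distrib]
  rw [Finset.prod_univ_sum, Fintype.piFinset_univ]

lemma conjTranspose_tensorMatrix (A : Fin n → Matrix (Fin d) (Fin d) ℂ) :
    (tensorMatrix A)ᴴ = tensorMatrix fun i => (A i)ᴴ := by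
  ext a b
  simp [tensorMatrix, conjTranspose_apply]

lemma trace_tensorMatrix (A : Fin n → Matrix (Fin d) (Fin d) ℂ) :
    (tensorMatrix A).trace = ∏ i, (A i).trace := by
  simp only [trace, tensorMatrix, diag_apply, of_apply]
  rw [Finset.prod_univ_sum, Fintype.piFinset_univ]

lemma Matrix.IsHermitian.ofReal_re_trace_mul {ι : Type*} [Fintype ι] {A B : Matrix ι ι ℂ}
    (hA : A.IsHermitian) (hB : B.IsHermitian) : (((A * B).trace.re : ℝ) : ℂ) = (A * B).trace := by
  refine Complex.conj_eq_iff_re.1 ?_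
  rw [← Complex.star_def, ← trace_conjTranspose, conjTranspose_mul, hA.eq, hB.eq, trace_mul_comm]

/-- Hermiticity makes each factor's trace real, so that taking real parts commutes with the product.
-/
lemma outcomeProb_tensorMatrix {Y : Fin n → Type*} (L : ∀ i, Y i → Matrix (Fin d) (Fin d) ℂ)
    (M : (∀ i, Y i) → Matrix (Fin n → Fin d) (Fin n → Fin d) ℂ)
    (hM : ∀ y, M y = tensorMatrix fun i => L i (y i)) {ρ : Matrix (Fin d) (Fin d) ℂ}
    (hρ : ρ.IsHermitian) (y : ∀ i, Y i) :
    outcomeProb M (tensorMatrix fun _ => ρ) y = ∏ i, outcomeProb (L i) ρ (y i) := by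
  rw [outcomeProb, hM, conjTranspose_tensorMatrix, tensorMatrix_mul, tensorMatrix_mul,
    trace_tensorMatrix]
  have h : ∀ i, (ρ * ((L i (y i))ᴴ * L i (y i))).trace =
      ((outcomeProb (L i) ρ (y i) : ℝ) : ℂ) := fun i =>
    (hρ.ofReal_re_trace_mul (isHermitian_conjTranspose_mul_self _)).symm
  simp_rw [h]
  rw [← Complex.ofReal_prod, Complex.ofReal_re]

lemma isHermitian_maxMixed (d : ℕ) : (maxMixed d).IsHermitian := by
  rw [IsHermitian, maxMixed, conjTranspose_smul, conjTranspose_one]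
  simp

lemma outcomeProb_maxMixed {Y : Type*} (M : Y → Matrix (Fin d) (Fin d) ℂ) (y : Y) :
    outcomeProb M (maxMixed d) y = ((M y)ᴴ * M y).trace.re / d := by
  rw [outcomeProb, maxMixed, smul_mul_assoc, one_mul, trace_smul, smul_eq_mul,
    ← Complex.ofReal_natCast, ← Complex.ofReal_inv, Complex.re_ofReal_mul]
  ring

lemma outcomeProb_nonneg {ι Y : Type*} [Fintype ι] (M : Y → Matrix ι ι ℂ) {ρ : Matrix ι ι ℂ}
    (hρ : ρ.PosSemidef) (y : Y) : 0 ≤ outcomeProb M ρ y := by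
  rw [outcomeProb, ← mul_assoc, trace_mul_cycle]
  exact (Complex.le_def.1 (hρ.mul_mul_conjTranspose_same (M y)).trace_nonneg).1

lemma IsMeasurement.hasSum_apply {ι Y : Type*} [Fintype ι] [DecidableEq ι] {M : Y → Matrix ι ι ℂ}
    (hM : IsMeasurement M) (i j : ι) :
    HasSum (fun y => ((M y)ᴴ * M y) i j) ((1 : Matrix ι ι ℂ) i j) :=
  HasSum.map hM (entryAddMonoidHom ℂ i j) (continuous_id.matrix_elem i j)

lemma IsMeasurement.hasSum_re_apply {ι Y : Type*} [Fintype ι] [DecidableEq ι]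
    {M : Y → Matrix ι ι ℂ} (hM : IsMeasurement M) (i j : ι) :
    HasSum (fun y => (((M y)ᴴ * M y) i j).re) ((1 : Matrix ι ι ℂ) i j).re :=
  Complex.hasSum_re (hM.hasSum_apply i j)

lemma IsMeasurement.hasSum_outcomeProb_maxMixed {Y : Type*} (hd : 0 < d)
    {M : Y → Matrix (Fin d) (Fin d) ℂ} (hM : IsMeasurement M) :
    HasSum (outcomeProb M (maxMixed d)) 1 := by
  have h := (hasSum_sum (s := Finset.univ) fun i _ => hM.hasSum_re_apply i i).div_const (d : ℝ)
  have hd' : (d : ℝ) ≠ 0 := by exact_mod_cast hd.ne'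
  simp only [one_apply_eq, Complex.one_re, Finset.sum_const, Finset.card_univ, Fintype.card_fin,
    nsmul_eq_mul, mul_one, div_self hd'] at h
  refine h.congr_fun ?_
  intro y
  rw [outcomeProb_maxMixed, trace, Complex.re_sum]
  rfl

end Tensor

/-! ### The random perturbed states and their likelihood ratios. -/

section Prior

open Matrix

variable {d m : ℕ}

/-- The Hermitian matrix with off-diagonal blocks `W` and `Wᵀ` on the coordinates `f` and `g`. -/
noncomputable def signBlock (f g : Fin m → Fin d) (W : Fin m × Fin m → ℤˣ) :
    Matrix (Fin d) (Fin d) ℂ :=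
  ∑ p, (((W p : ℤ) : ℝ) : ℂ) • (single (f p.1) (g p.2) (1 : ℂ) + single (g p.2) (f p.1) (1 : ℂ))

variable (f g : Fin m → Fin d) (W : Fin m × Fin m → ℤˣ)

lemma signBlock_neg : signBlock f g (-W) = -signBlock f g W := by
  rw [signBlock, signBlock, ← Finset.sum_neg_distrib]
  refine Finset.sum_congr rfl fun p _ => ?_
  rw [← neg_smul]
  simp

lemma isHermitian_signBlock : (signBlock f g W).IsHermitian := by
  rw [IsHermitian, signBlock, conjTranspose_sum]
  refine Finset.sum_congr rfl fun p _ => ?_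
  rw [conjTranspose_smul, conjTranspose_add, conjTranspose_single, conjTranspose_single, star_one,
    add_comm, Complex.star_def, Complex.conj_ofReal]

variable {f g}

lemma trace_signBlock (hfg : ∀ j k, f j ≠ g k) : (signBlock f g W).trace = 0 := by
  rw [signBlock, trace_sum]
  refine Finset.sum_eq_zero fun p _ => ?_
  rw [trace_smul, trace_add, trace_single_eq_of_ne _ _ _ (hfg _ _),
    trace_single_eq_of_ne _ _ _ (hfg _ _).symm]
  simp

lemma re_trace_signBlock_mul {E : Matrix (Fin d) (Fin d) ℂ} (hE : E.IsHermitian) :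
    (signBlock f g W * E).trace.re =
      signForm (fun p => 2 * (E (f p.1) (g p.2)).re) W := by
  rw [signBlock, Finset.sum_mul, trace_sum, Complex.re_sum, signForm]
  refine Finset.sum_congr rfl fun p _ => ?_
  have h : (E (g p.2) (f p.1)).re = (E (f p.1) (g p.2)).re := by
    rw [← hE.apply (g p.2) (f p.1)]
    simp
  rw [smul_mul_assoc, trace_smul, smul_eq_mul, Complex.re_ofReal_mul, add_mul, trace_add,
    trace_single_mul, trace_single_mul, Complex.add_re, one_smul, one_smul, h]
  ring

lemma signBlock_apply (hf : Function.Injective f) (hg : Function.Injective g)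
    (hfg : ∀ j k, f j ≠ g k) (j k : Fin m) :
    signBlock f g W (f j) (g k) = (((W (j, k) : ℤ) : ℝ) : ℂ) := by
  rw [signBlock, Matrix.sum_apply, Finset.sum_eq_single (j, k)]
  · simp [(hfg j k).symm]
  · rintro ⟨j', k'⟩ _ hne
    have h1 : ¬ (f j' = f j ∧ g k' = g k) := fun h => hne (by rw [hf h.1, hg h.2])
    have h2 : ¬ (g k' = f j ∧ f j' = g k) := fun h => hfg j k' h.1.symm
    simp only [Matrix.smul_apply, Matrix.add_apply, Matrix.single_apply, if_neg h1, if_neg h2,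
      add_zero, smul_zero]
  · simp

lemma re_trace_signBlock_sq (hf : Function.Injective f) (hg : Function.Injective g)
    (hfg : ∀ j k, f j ≠ g k) :
    (signBlock f g W * signBlock f g W).trace.re = 2 * (m : ℝ) ^ 2 := by
  rw [re_trace_signBlock_mul W (isHermitian_signBlock f g W), signForm]
  calc _ = ∑ _p : Fin m × Fin m, (2 : ℝ) := by
        refine Finset.sum_congr rfl fun p _ => ?_
        rw [signBlock_apply W hf hg hfg, Complex.ofReal_re]
        rcases Int.units_eq_one_or (W p) with h | h <;> simp [h]
    _ = _ := by
        simp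
        ring

lemma dotProduct_signBlock_mulVec (x : Fin d → ℂ) :
    star x ⬝ᵥ (signBlock f g W *ᵥ x) =
      ((2 * signBilin W (fun j => (x (f j)).re) (fun k => (x (g k)).re) +
        2 * signBilin W (fun j => (x (f j)).im) (fun k => (x (g k)).im) : ℝ) : ℂ) := by
  rw [signBlock, sum_mulVec, dotProduct_sum, signBilin, signBilin, signForm, signForm,
    Finset.mul_sum, Finset.mul_sum, ← Finset.sum_add_distrib, Complex.ofReal_sum]
  refine Finset.sum_congr rfl fun p _ => ?_
  have hup : ∀ (i : Fin d) (c : ℂ),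
      star x ⬝ᵥ Function.update 0 i c = starRingEnd ℂ (x i) * c := fun i c =>
    dotProduct_single _ _ _
  rw [smul_mulVec, dotProduct_smul, add_mulVec, dotProduct_add, single_mulVec, single_mulVec,
    hup, hup]
  apply Complex.ext
  · simp
    ring
  · simp
    ring

/-- As `W` is real, the quadratic form splits over the real and imaginary parts of `x`. The bound
for `-W` applies to each, and the disjoint ranges of `f` and `g` keep the total below `‖x‖²`. -/
lemma posSemidef_add_signBlock {S : ℝ} (hW : SignOpBound S W) (hf : Function.Injective f)
    (hg : Function.Injective g) (hfg : ∀ j k, f j ≠ g k) :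
    ((S : ℂ) • (1 : Matrix (Fin d) (Fin d) ℂ) + signBlock f g W).PosSemidef := by
  have hS : 0 ≤ S := by simpa [signBilin, signForm] using hW 0 0 (by simp) (by simp)
  refine PosSemidef.of_dotProduct_mulVec_nonneg ?_ fun x => ?_
  · refine IsHermitian.add ?_ (isHermitian_signBlock f g W)
    rw [IsHermitian, conjTranspose_smul, conjTranspose_one, Complex.star_def, Complex.conj_ofReal]
  have hxx : star x ⬝ᵥ x = ((∑ i, ‖x i‖ ^ 2 : ℝ) : ℂ) := by
    rw [dotProduct, Complex.ofReal_sum]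
    refine Finset.sum_congr rfl fun i _ => ?_
    rw [Pi.star_apply, Complex.star_def, ← Complex.normSq_eq_conj_mul_self,
      Complex.normSq_eq_norm_sq]
  rw [add_mulVec, dotProduct_add, dotProduct_signBlock_mulVec, smul_mulVec, one_mulVec,
    dotProduct_smul, hxx, smul_eq_mul, ← Complex.ofReal_mul, ← Complex.ofReal_add]
  refine Complex.zero_le_real.2 ?_
  have h1 := hW.neg.two_mul_le (fun j => (x (f j)).re) (fun k => (x (g k)).re)
  have h2 := hW.neg.two_mul_le (fun j => (x (f j)).im) (fun k => (x (g k)).im)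
  have hneg : ∀ u v : Fin m → ℝ, signBilin (-W) u v = -signBilin W u v := fun u v =>
    signForm_neg _ _
  rw [hneg] at h1 h2
  have hn : ∀ z : ℂ, z.re ^ 2 + z.im ^ 2 = ‖z‖ ^ 2 := fun z => by
    rw [← Complex.normSq_eq_norm_sq, Complex.normSq_apply]; ring
  have h3 : ∑ j, ‖x (f j)‖ ^ 2 + ∑ k, ‖x (g k)‖ ^ 2 ≤ ∑ i, ‖x i‖ ^ 2 := by
    have hinj : Function.Injective (Sum.elim f g) := hf.sumElim hg hfg
    calc _ = ∑ s : Fin m ⊕ Fin m, ‖x (Sum.elim f g s)‖ ^ 2 := by simp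
      _ = ∑ i ∈ Finset.univ.image (Sum.elim f g), ‖x i‖ ^ 2 :=
          (Finset.sum_image (f := fun i => ‖x i‖ ^ 2) fun a _ b _ h => hinj h).symm
      _ ≤ _ := Finset.sum_le_sum_of_subset_of_nonneg (Finset.subset_univ _)
          fun _ _ _ => sq_nonneg _
  simp_rw [← hn, Finset.sum_add_distrib] at h3
  simp_rw [← hn, Finset.sum_add_distrib]
  nlinarith [mul_le_mul_of_nonneg_left h3 hS]

/-- The perturbation of the maximally mixed state by a scaled block sign matrix. -/
noncomputable def signState (f g : Fin m → Fin d) (τ : ℝ) (W : Fin m × Fin m → ℤˣ) :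
    Matrix (Fin d) (Fin d) ℂ :=
  maxMixed d + (τ : ℂ) • signBlock f g W

lemma isState_signState (hd : 0 < d) {S τ : ℝ} (hτ : 0 ≤ τ) (hτS : τ * S ≤ 1 / d)
    (hW : SignOpBound S W) (hf : Function.Injective f) (hg : Function.Injective g)
    (hfg : ∀ j k, f j ≠ g k) : IsState (signState f g τ W) := by
  have hd' : (d : ℂ) ≠ 0 := by exact_mod_cast hd.ne'
  constructor
  · have h1 := (posSemidef_add_signBlock W hW hf hg hfg).smul (Complex.zero_le_real.2 hτ)
    have h2 : ((((1 / d - τ * S : ℝ)) : ℂ) • (1 : Matrix (Fin d) (Fin d) ℂ)).PosSemidef :=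
      PosSemidef.one.smul (Complex.zero_le_real.2 (by linarith))
    convert h2.add h1 using 1
    rw [signState, maxMixed, smul_add, smul_smul, ← add_assoc, ← add_smul]
    congr 2
    push_cast
    ring
  · rw [signState, trace_add, trace_smul, trace_signBlock W hfg, maxMixed, trace_smul, trace_one]
    simp [hd']

/-- Hölder's inequality: the perturbation has squared Hilbert–Schmidt norm `2 τ² m²` and operator
norm at most `τ S`. -/
lemma le_qTraceNorm_signState {S τ : ℝ} (hS : 0 < S) (hτ : 0 < τ)
    (hW : SignOpBound S W) (hf : Function.Injective f) (hg : Function.Injective g)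
    (hfg : ∀ j k, f j ≠ g k) :
    τ * (m : ℝ) ^ 2 ≤ S * qTraceNorm (signState f g τ W - maxMixed d) := by
  have h1 := (posSemidef_add_signBlock W hW hf hg hfg).smul (Complex.zero_le_real.2 hτ.le)
  have h2 := (posSemidef_add_signBlock (-W) hW.neg hf hg hfg).smul (Complex.zero_le_real.2 hτ.le)
  rw [signBlock_neg, ← sub_eq_add_neg, smul_sub, smul_smul, ← Complex.ofReal_mul] at h2
  rw [smul_add, smul_smul, ← Complex.ofReal_mul] at h1
  have h3 := posSemidef_sq_sub_of_pm (mul_pos hτ hS) h2 h1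
  have e : signState f g τ W - maxMixed d = (τ : ℂ) • signBlock f g W := by
    rw [signState, add_sub_cancel_left]
  have hH : ((τ : ℂ) • signBlock f g W)ᴴ = (τ : ℂ) • signBlock f g W := by
    rw [conjTranspose_smul, (isHermitian_signBlock f g W).eq, Complex.star_def,
      Complex.conj_ofReal]
  have h4 := trace_conjTranspose_mul_self_le (A := (τ : ℂ) • signBlock f g W)
    (mul_pos hτ hS).le (by rw [hH]; exact h3)
  rw [hH, smul_mul_assoc, mul_smul_comm, trace_smul, trace_smul, smul_eq_mul, smul_eq_mul,
    Complex.re_ofReal_mul, Complex.re_ofReal_mul, re_trace_signBlock_sq W hf hg hfg] at h4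
  rw [e]
  refine le_of_mul_le_mul_left ?_ (by positivity : 0 < 2 * τ)
  linarith

/-- The coefficients of the likelihood ratio of an outcome as a linear form in the signs. -/
noncomputable def likelihoodCoeff {Y : Type*} (f g : Fin m → Fin d) (τ : ℝ)
    (M : Y → Matrix (Fin d) (Fin d) ℂ) (y : Y) (p : Fin m × Fin m) : ℝ :=
  2 * τ * (((M y)ᴴ * M y) (f p.1) (g p.2)).re / outcomeProb M (maxMixed d) y

lemma outcomeProb_maxMixed_mul_likelihoodCoeff {Y : Type*} (hd : 0 < d) (τ : ℝ)
    (M : Y → Matrix (Fin d) (Fin d) ℂ) (y : Y) (p : Fin m × Fin m) :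
    outcomeProb M (maxMixed d) y * likelihoodCoeff f g τ M y p =
      2 * τ * (((M y)ᴴ * M y) (f p.1) (g p.2)).re := by
  have hd' : (d : ℝ) ≠ 0 := by exact_mod_cast hd.ne'
  -- An outcome of probability zero under the maximally mixed state has `M y = 0`, so the value
  -- given to division by zero is harmless.
  rcases eq_or_ne (outcomeProb M (maxMixed d) y) 0 with h | h
  · rw [h, zero_mul]
    rw [outcomeProb_maxMixed, div_eq_zero_iff, or_iff_left hd'] at h
    have h0 : ((M y)ᴴ * M y).trace = 0 := by
      have := (isHermitian_one (n := Fin d) (α := ℂ)).ofReal_re_trace_mul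
        (isHermitian_conjTranspose_mul_self (M y))
      rw [one_mul, h] at this
      simpa using this.symm
    rw [trace_conjTranspose_mul_self_eq_zero_iff.1 h0]
    simp
  · rw [likelihoodCoeff]
    field_simp

lemma outcomeProb_signState {Y : Type*} (hd : 0 < d) (τ : ℝ)
    (M : Y → Matrix (Fin d) (Fin d) ℂ) (y : Y) :
    outcomeProb M (signState f g τ W) y =
      outcomeProb M (maxMixed d) y * (1 + signForm (likelihoodCoeff f g τ M y) W) := by
  rw [mul_add, mul_one, mul_signForm]
  simp_rw [outcomeProb_maxMixed_mul_likelihoodCoeff hd]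
  rw [outcomeProb, signState, add_mul, trace_add, Complex.add_re, smul_mul_assoc, trace_smul,
    smul_eq_mul, Complex.re_ofReal_mul,
    re_trace_signBlock_mul W (isHermitian_conjTranspose_mul_self (M y)), mul_signForm]
  congr 2
  funext p
  ring

/-- The effects sum to the identity, whose off-diagonal entries vanish. -/
lemma IsMeasurement.hasSum_likelihoodCoeff {Y : Type*} (hd : 0 < d) (τ : ℝ)
    {M : Y → Matrix (Fin d) (Fin d) ℂ} (hM : IsMeasurement M) (hfg : ∀ j k, f j ≠ g k)
    (p : Fin m × Fin m) :
    HasSum (fun y => outcomeProb M (maxMixed d) y * likelihoodCoeff f g τ M y p) 0 := by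
  simp_rw [outcomeProb_maxMixed_mul_likelihoodCoeff hd]
  have h := (hM.hasSum_re_apply (f p.1) (g p.2)).mul_left (2 * τ)
  rw [one_apply_ne (hfg _ _)] at h
  simpa using h

lemma IsGentle.sum_sq_likelihoodCoeff_le {Y : Type*} {α : ℝ} (τ : ℝ)
    {M : Y → Matrix (Fin d) (Fin d) ℂ} (hM : IsGentle α M) (hα0 : 0 ≤ α) (hα : α ≤ 1 / 2)
    (hf : Function.Injective f) (hfg : ∀ j k, f j ≠ g k) (y : Y) :
    ∑ p, likelihoodCoeff f g τ M y p ^ 2 ≤ 43904 * τ ^ 2 * α ^ 2 * m := by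
  have h := hM.sum_normSq_block_le hα0 hα y hf hfg
  rw [← outcomeProb_maxMixed] at h
  set t := outcomeProb M (maxMixed d) y with ht
  have e : ∑ p, likelihoodCoeff f g τ M y p ^ 2 =
      4 * τ ^ 2 * (∑ k, ∑ j, (((M y)ᴴ * M y) (f j) (g k)).re ^ 2) / t ^ 2 := by
    rw [Fintype.sum_prod_type_right, Finset.mul_sum, Finset.sum_div]
    refine Finset.sum_congr rfl fun k _ => ?_
    rw [Finset.mul_sum, Finset.sum_div]
    refine Finset.sum_congr rfl fun j _ => ?_
    rw [likelihoodCoeff, ← ht]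
    ring
  have h2 : ∑ k, ∑ j, (((M y)ᴴ * M y) (f j) (g k)).re ^ 2 ≤ 10976 * α ^ 2 * m * t ^ 2 := by
    refine le_trans ?_ h
    refine Finset.sum_le_sum fun k _ => Finset.sum_le_sum fun j _ => ?_
    rw [← sq_abs]
    exact pow_le_pow_left₀ (abs_nonneg _) (Complex.abs_re_le_norm _) 2
  rw [e]
  refine div_le_of_le_mul₀ (sq_nonneg _) (by positivity) ?_
  calc _ ≤ 4 * τ ^ 2 * (10976 * α ^ 2 * m * t ^ 2) := by gcongr
    _ = _ := by ring

end Prior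

/-! ### Reduction of tests to the mixture bound, and the final constants. -/

section Testing

variable {n d : ℕ} {α : ℝ} {Ω : Type*} [MeasurableSpace Ω] {Y : Fin n → Type*}

namespace RandomizedGentleTest

lemma measurable_outcomeProb (T : RandomizedGentleTest n d α Ω Y)
    (ρ : Matrix (Fin n → Fin d) (Fin n → Fin d) ℂ) (y : ∀ i, Y i) :
    Measurable fun ω => outcomeProb (T.meas ω) ρ y := by
  simp only [outcomeProb, Matrix.trace, Matrix.diag_apply, Matrix.mul_apply,
    Matrix.conjTranspose_apply]
  refine Complex.measurable_re.comp (Finset.measurable_sum _ fun a _ =>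
    Finset.measurable_sum _ fun b _ => (Finset.measurable_sum _ fun c _ => ?_).const_mul _)
  exact (Complex.continuous_conj.measurable.comp (T.measurable_meas y c b)).mul
    (T.measurable_meas y c a)

lemma measurable_decisionProb_integrand [∀ i, Countable (Y i)]
    (T : RandomizedGentleTest n d α Ω Y) (ρ : Matrix (Fin d) (Fin d) ℂ) (b : Bool) :
    Measurable fun ω => ∑' y, (if T.decision ω y = b then
      ENNReal.ofReal (outcomeProb (T.meas ω) (tensorMatrix fun _ => ρ) y) else 0) := by
  refine Measurable.tsum fun y => Measurable.ite ?_
    (T.measurable_outcomeProb _ y).ennreal_ofReal measurable_const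
  exact T.measurable_decision y (measurableSet_singleton b)

lemma decisionProb_true_add_false [∀ i, Countable (Y i)] (hd : 0 < d)
    (T : RandomizedGentleTest n d α Ω Y) (μ : Measure Ω) [IsProbabilityMeasure μ] :
    T.decisionProb μ (maxMixed d) true + T.decisionProb μ (maxMixed d) false = 1 := by
  rw [decisionProb, decisionProb,
    ← lintegral_add_left (T.measurable_decisionProb_integrand _ true)]
  have h : ∀ ω, (∑' y, (if T.decision ω y = true then
      ENNReal.ofReal (outcomeProb (T.meas ω) (tensorMatrix fun _ => maxMixed d) y) else 0)) +
      ∑' y, (if T.decision ω y = false then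
      ENNReal.ofReal (outcomeProb (T.meas ω) (tensorMatrix fun _ => maxMixed d) y) else 0) = 1 := by
    intro ω
    obtain ⟨L, hL, -, hM⟩ := T.locallyGentle ω
    have hsum := fun i => (hL i).hasSum_outcomeProb_maxMixed hd
    have hnn : ∀ i y, 0 ≤ outcomeProb (L i) (maxMixed d) y := fun i y => by
      rw [outcomeProb_maxMixed]
      exact div_nonneg (Complex.le_def.1
        (Matrix.posSemidef_conjTranspose_mul_self (L i y)).trace_nonneg).1 (Nat.cast_nonneg d)
    rw [← ENNReal.tsum_add]
    calc _ = ∑' y : (∀ i, Y i), ∏ i, ENNReal.ofReal (outcomeProb (L i) (maxMixed d) (y i)) := by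
          refine tsum_congr fun y => ?_
          rw [outcomeProb_tensorMatrix L _ hM (isHermitian_maxMixed d),
            ← ENNReal.ofReal_prod_of_nonneg fun i _ => hnn i _]
          cases T.decision ω y <;> simp
      _ = ∏ i, ∑' y, ENNReal.ofReal (outcomeProb (L i) (maxMixed d) y) :=
          ENNReal.tsum_pi_prod fun i y => ENNReal.ofReal (outcomeProb (L i) (maxMixed d) y)
      _ = 1 := by
          refine Finset.prod_eq_one fun i _ => ?_
          rw [← ENNReal.ofReal_tsum_of_nonneg (hnn i) (hsum i).summable, (hsum i).tsum_eq,
            ENNReal.ofReal_one]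
  simp_rw [h]
  simp

/-- With few copies, no test rejects the perturbed states much more often on average than the
maximally mixed state. -/
lemma sum_decisionProb_signState_le [∀ i, Countable (Y i)] {m : ℕ} (hm : 0 < m) (hd : 0 < d)
    (hα0 : 0 ≤ α) (hα : α ≤ 1 / 2) (T : RandomizedGentleTest n d α Ω Y) (μ : Measure Ω)
    [IsProbabilityMeasure μ] {f g : Fin m → Fin d} (hf : Function.Injective f)
    (hg : Function.Injective g) (hfg : ∀ j k, f j ≠ g k) {τ : ℝ} (hτ : 0 ≤ τ)
    (hτd : τ * (8 * √m) ≤ 1 / d) (hn : n * (43904 * τ ^ 2 * α ^ 2 * m) ≤ 1 / 4) :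
    ∑ W ∈ goodSigns m, T.decisionProb μ (signState f g τ W) true ≤
      (goodSigns m).card * (T.decisionProb μ (maxMixed d) true + ENNReal.ofReal (5 / 16)) := by
  simp only [decisionProb]
  rw [← lintegral_finsetSum _ fun W _ => T.measurable_decisionProb_integrand _ true]
  -- The comparison holds for each fixed seed with the same constant, so it survives integration
  -- over the seed.
  have h : ∀ ω, ∑ W ∈ goodSigns m, ∑' y, (if T.decision ω y = true then
      ENNReal.ofReal (outcomeProb (T.meas ω) (tensorMatrix fun _ => signState f g τ W) y) else 0) ≤
      (goodSigns m).card * ((∑' y, (if T.decision ω y = true then ENNReal.ofReal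
        (outcomeProb (T.meas ω) (tensorMatrix fun _ => maxMixed d) y) else 0)) +
        ENNReal.ofReal (5 / 16)) := by
    intro ω
    obtain ⟨L, hL, hgen, hM⟩ := T.locallyGentle ω
    have hstate : ∀ W ∈ goodSigns m, IsState (signState f g τ W) := fun W hW =>
      isState_signState W hd hτ hτd (mem_goodSigns.1 hW) hf hg hfg
    have hnn : ∀ i y, 0 ≤ outcomeProb (L i) (maxMixed d) y := fun i y => by
      rw [outcomeProb_maxMixed]
      exact div_nonneg (Complex.le_def.1
        (Matrix.posSemidef_conjTranspose_mul_self (L i y)).trace_nonneg).1 (Nat.cast_nonneg d)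
    have key := sum_tsum_prod_le (goodSigns m)
      (fun W hW => mem_goodSigns.2 (mem_goodSigns.1 hW).neg) (card_goodSigns hm)
      (fun i => outcomeProb (L i) (maxMixed d)) hnn
      (fun i => (hL i).hasSum_outcomeProb_maxMixed hd)
      (fun i => likelihoodCoeff f g τ (L i))
      (fun i y => (hgen i).sum_sq_likelihoodCoeff_le τ hα0 hα hf hfg y) hn
      (fun i p => (hL i).hasSum_likelihoodCoeff hd τ hfg p)
      (fun W hW i y => by
        rw [← outcomeProb_signState W hd]
        exact outcomeProb_nonneg _ (hstate W hW).1 y)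
      (fun y => T.decision ω y = true)
    simp_rw [outcomeProb_tensorMatrix L _ hM (isHermitian_maxMixed d)]
    refine le_trans (le_of_eq ?_) key
    refine Finset.sum_congr rfl fun W hW => tsum_congr fun y => ?_
    rw [outcomeProb_tensorMatrix L _ hM (hstate W hW).1.isHermitian]
    simp_rw [outcomeProb_signState W hd]
  refine (lintegral_mono h).trans ?_
  rw [lintegral_const_mul' _ _ (ENNReal.natCast_ne_top _), lintegral_add_right _ measurable_const]
  simp

/-- A test with few copies cannot tell all the perturbed states from the maximally mixed state. -/
lemma not_certifies [∀ i, Countable (Y i)] {m : ℕ} {ε τ : ℝ} (hm : 0 < m) (hd : 0 < d)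
    (hα0 : 0 ≤ α) (hα : α ≤ 1 / 2) (T : RandomizedGentleTest n d α Ω Y) (μ : Measure Ω)
    [IsProbabilityMeasure μ] (hmd : 2 * m ≤ d) (hτ : 0 < τ)
    (hτd : τ * (8 * √m) ≤ 1 / d) (hετ : 8 * √m * ε < τ * m ^ 2)
    (hn : n * (43904 * τ ^ 2 * α ^ 2 * m) ≤ 1 / 4) : ¬ T.Certifies μ ε := by
  rintro ⟨h0, h1⟩
  set f : Fin m → Fin d := fun j => ⟨j, by omega⟩ with hfdef
  set g : Fin m → Fin d := fun j => ⟨m + j, by omega⟩ with hgdef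
  have hf : Function.Injective f := fun a b h => by
    simpa [hfdef, Fin.ext_iff] using h
  have hg : Function.Injective g := fun a b h => by
    simpa [hgdef, Fin.ext_iff] using h
  have hfg : ∀ j k, f j ≠ g k := fun j k h => by
    have := Fin.ext_iff.1 h
    simp only [hfdef, hgdef] at this
    omega
  have hS : 0 < 8 * √(m : ℝ) := by
    have : (0 : ℝ) < m := by exact_mod_cast hm
    positivity
  have hN : (0 : ℝ) < (goodSigns m).card := by
    have h2 := card_goodSigns hm
    have : (0 : ℝ) < Fintype.card (Fin m × Fin m → ℤˣ) := by exact_mod_cast Fintype.card_pos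
    linarith
  have hN' : ((goodSigns m).card : ℝ≥0∞) ≠ 0 := by
    have : 0 < (goodSigns m).card := by exact_mod_cast hN
    exact_mod_cast this.ne'
  have hlow : ((goodSigns m).card : ℝ≥0∞) * (2 / 3) ≤
      ∑ W ∈ goodSigns m, T.decisionProb μ (signState f g τ W) true := by
    rw [← nsmul_eq_mul]
    refine Finset.card_nsmul_le_sum _ _ _ fun W hW => h1 _
      (isState_signState W hd hτ.le hτd (mem_goodSigns.1 hW) hf hg hfg) ?_
    have h3 := le_qTraceNorm_signState W hS hτ (mem_goodSigns.1 hW) hf hg hfg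
    exact lt_of_mul_lt_mul_left (hετ.trans_le h3) hS.le
  have hup := sum_decisionProb_signState_le hm hd hα0 hα T μ hf hg hfg hτ.le hτd hn
  have h4 := (ENNReal.mul_le_mul_iff_right hN' (ENNReal.natCast_ne_top _)).1 (hlow.trans hup)
  have h5 := T.decisionProb_true_add_false hd μ
  set A := T.decisionProb μ (maxMixed d) true
  set B := T.decisionProb μ (maxMixed d) false
  have hA : A ≠ ⊤ := fun h => by simp [h] at h5
  have hB : B ≠ ⊤ := fun h => by simp [h] at h5
  -- The contradiction is numerical: `A ≤ 1 / 3` and `2 / 3 ≤ A + 5 / 16`.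
  have e5 := congrArg ENNReal.toReal h5
  rw [ENNReal.toReal_add hA hB, ENNReal.toReal_one] at e5
  have e4 := ENNReal.toReal_mono (ENNReal.add_ne_top.2 ⟨hA, ENNReal.ofReal_ne_top⟩) h4
  rw [ENNReal.toReal_add hA ENNReal.ofReal_ne_top, ENNReal.toReal_ofReal (by norm_num),
    ENNReal.toReal_div] at e4
  have e0 := ENNReal.toReal_mono hB h0
  rw [ENNReal.toReal_div] at e0
  norm_num at e4 e0
  linarith

end RandomizedGentleTest

end Testing

theorem mainTheorem3 :
    ∃ c : ℝ, 0 < c ∧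
      ∀ (d n : ℕ) (ε α : ℝ), 2 ≤ d → 0 < ε → ε < 1 / 200 → 0 < α → α < 1 / 2 →
      ∀ (Ω : Type*) [MeasurableSpace Ω] (μ : Measure Ω) [IsProbabilityMeasure μ]
        (Y : Fin n → Type*) [∀ i, Countable (Y i)] (T : RandomizedGentleTest n d α Ω Y),
        T.Certifies μ ε → c * (d ^ 2 / (ε ^ 2 * α ^ 2)) ≤ n := by
  refine ⟨1 / 10 ^ 9, by norm_num, ?_⟩
  intro d n ε α hd hε hε' hα hα' Ω _ μ _ Y _ T hT
  by_contra hcon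
  push Not at hcon
  -- The factor `3` is attained at `d = 3`, where `m = 1`.
  obtain ⟨m, hm0, hmd, hdm⟩ : ∃ m : ℕ, 0 < m ∧ 2 * m ≤ d ∧ d ≤ 3 * m :=
    ⟨d / 2, by omega, by omega, by omega⟩
  have hm : (0 : ℝ) < m := by exact_mod_cast hm0
  have hd0 : (0 : ℝ) < d := by exact_mod_cast (by omega : 0 < d)
  have hdm' : (d : ℝ) ≤ 3 * m := by exact_mod_cast hdm
  have hs := Real.sqrt_pos.2 hm
  have hsq := Real.sq_sqrt hm.le
  -- The factor `81 / 10` slightly exceeds `8`, which makes the distance strictly larger than `ε`.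
  -- Positivity needs `64.8 ε d ≤ m`, which follows from `d ≤ 3 m` and `ε < 1 / 200`.
  refine T.not_certifies (m := m) (τ := 81 / 10 * ε / (m * √m)) hm0 (by omega) hα.le hα'.le μ hmd
    (by positivity) ?_ ?_ ?_ hT
  · rw [le_div_iff₀ hd0]
    have : 81 / 10 * ε / (m * √m) * (8 * √m) * d = 324 / 5 * ε * d / m := by
      field_simp
      ring
    rw [this, div_le_one hm]
    nlinarith
  · have : 81 / 10 * ε / (m * √m) * (m : ℝ) ^ 2 = 81 / 10 * ε * √m := by
      rw [div_mul_eq_mul_div, div_eq_iff (by positivity)]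
      linear_combination (-(81 / 10) * ε * m) * hsq
    rw [this]
    nlinarith [mul_pos hε hs]
  · have e : (n : ℝ) * (43904 * (81 / 10 * ε / (m * √m)) ^ 2 * α ^ 2 * m) =
        43904 * (81 / 10) ^ 2 * (n * (ε ^ 2 * α ^ 2)) / m ^ 2 := by
      rw [div_pow, mul_pow (m : ℝ), hsq]
      field_simp
    have h1 : n * (ε ^ 2 * α ^ 2) ≤ 1 / 10 ^ 9 * (d : ℝ) ^ 2 := by
      rw [mul_div_assoc', lt_div_iff₀ (by positivity)] at hcon
      exact hcon.le
    have h2 : (d : ℝ) ^ 2 ≤ 9 * m ^ 2 := by nlinarith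
    rw [e, div_le_iff₀ (by positivity)]
    nlinarith
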